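/- Let $\mathbb H$ be a separable complex Hilbert space with a fixed complete orthonormal system $(e_j)$ (the "real" system); put $\overline x=\sum_j\overline{\langle x,e_j\rangle}e_j$, call $x$ real if $\overline x=x$, and let $[x\otimes y](z)=\langle z,y\rangle x$. Write $\|A\|_{\rm tr}=\sum_j\langle (A^*A)^{1/2}e_j,e_j\rangle$ and $\|A\|_{\rm HS}=\|A^*A\|_{\rm tr}^{1/2}$, and let $|\cdot|$ denote Lebesgue measure on $\mathbb R^d$. **Process (Assumption C).** Let $X=\{X(t),t\in\mathbb R^d\}$ be a zero-mean, real, second-order stationary process in $\mathbb H$: $\mathbb E\|X(t)\|^2<\infty$, and $\mathbb E[X(t)\otimes X(s)]$ and $\mathbb E[X(t)\otimes\overline{X(s)}]$ depend only on $t-s$. Let $C(h)=\mathbb E[X(t+h)\otimes X(t)]$. Assume that $\int_{\mathbb R^d}\|C(h)\|_{\rm tr}\,dh<\infty$ and that, for some $0<\gamma\le 1$ and some finite constant $M_C$, $$\int_{\mathbb R^d}\ \sup_{y:\|x-y\|\le\delta}\|C(y)-C(x)\|_{\rm tr}\,dx\le M_C\,\delta^\gamma\qquad\text{for all }\delta\in(0,1).$$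 Let $f(\theta)=(2\pi)^{-d}\int_{\mathbb R^d}e^{ih^\top\theta}C(h)\,dh$ be the spectral density. **Kernel (Assumption K).** Let $K:\mathbb R^d\to[0,\infty)$ be continuous, such that $S_K=\{u:K(u)>0\}$ is bounded and contains $0$, $\sup K=K(0)=1$, and, for some $\epsilon>0$, $K$ is differentiable with bounded gradient on $\{\|u\|<\epsilon\}$. Assume moreover that $K$ is Lipschitz on $\mathbb R^d$. **Sampling (Assumption S).** For each $n$ let $t_{n,1},\dots,t_{n,n}\in\mathbb R^d$ be distinct nonrandom points with closed convex hull $T_n$, let $V(t_{n,i})=\{x\in T_n:\|x-t_{n,i}\|\le\|x-t_{n,j}\|\ \forall j\}$ be their Voronoi cells, and let $\delta_n=\max_i\sup_{x\in V(t_{n,i})}\|x-t_{n,i}\|$. Assume that $\delta_n\to0$, that $|T_n|\to\infty$, and that $T_n/|T_n|^{1/d}$ converges in the Hausdorff metric to a fixed bounded convex set with nonempty interior. **Estimator.** For a bandwidth $\Delta_n$ let $$\hat f_n(\theta)=\frac1{(2\pi)^d}\sum_{i,j=1}^n e^{i(t_{n,i}-t_{n,j})^\top\theta}\,\frac{X(t_{n,i})\otimes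 X(t_{n,j})}{|T_n\cap(T_n-(t_{n,i}-t_{n,j}))|}\,K\!\Big(\frac{t_{n,i}-t_{n,j}}{\Delta_n}\Big)|V(t_{n,i})|\,|V(t_{n,j})|$$ (in the exponent $i$ is the imaginary unit; terms with $K=0$ are $0$). **Theorem.** Suppose that $\Delta_n\to\infty$, that $\Delta_n^d/|T_n|\to0$, and that $\Delta_n S_K\subset T_n-T_n$ for all sufficiently large $n$. Then, for every bounded $\Theta\subset\mathbb R^d$, $$\|\mathbb E\hat f_n(\theta)-f(\theta)\|_{\rm HS}=\mathcal O\big(\delta_n^\gamma+B_1(\Delta_n,\theta)+B_2(\Delta_n,\theta)\big)\qquad\text{uniformly in }\theta\in\Theta\text{ as }n\to\infty,$$ that is, there is a finite $M$ such that for all sufficiently large $n$ and all $\theta\in\Theta$ the left-hand side is at most $M(\delta_n^\gamma+B_1(\Delta_n,\theta)+B_2(\Delta_n,\theta))$, where $$B_1(\Delta_n,\theta)=\Big\|\int_{\Delta_nS_K}e^{ih^\top\theta}C(h)\big(1-K(h/\Delta_n)\big)dh\Big\|_{\rm HS},\qquad B_2(\Delta_n,\theta)=\Big\|\int_{\mathbb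 R^d\setminus\Delta_nS_K}e^{ih^\top\theta}C(h)\,dh\Big\|_{\rm HS}.$$ In particular, $\sup_{\theta\in\Theta}\|\mathbb E\hat f_n(\theta)-f(\theta)\|_{\rm HS}=\mathcal O\big(\delta_n^\gamma+\sup_{\theta\in\Theta}B_1(\Delta_n,\theta)+\sup_{\theta\in\Theta}B_2(\Delta_n,\theta)\big)$. -/

import Mathlib

open MeasureTheory Filter Topology
open scoped ENNReal NNReal Pointwise

noncomputable section

namespace SpectralBias

/-- The space of locations and frequencies: `ℝ^d` with the Euclidean norm. -/
abbrev E (d : ℕ) : Type := EuclideanSpace ℝ (Fin d)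

/-! ### Trace norm and Hilbert-Schmidt norm -/

section Operators

variable {H : Type*} [NormedAddCommGroup H] [InnerProductSpace ℂ H] [CompleteSpace H]
variable {ι : Type*}

/-- The trace norm `∑ⱼ ⟨(A* A)^{1/2} eⱼ, eⱼ⟩ ∈ [0, ∞]`, computed in a complete orthonormal system
`e` (its value does not depend on `e`). `CFC.abs A` is `(A* A)^{1/2}`; the summands are
nonnegative real numbers. -/
def traceNorm (e : HilbertBasis ι ℂ H) (A : H →L[ℂ] H) : ℝ≥0∞ :=
  ∑' j, ENNReal.ofReal (RCLike.re (inner ℂ (e j) (CFC.abs A (e j))))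

/-- The Hilbert-Schmidt norm `‖A* A‖_tr^{1/2} ∈ [0, ∞]`. -/
def hsNorm (e : HilbertBasis ι ℂ H) (A : H →L[ℂ] H) : ℝ≥0∞ :=
  traceNorm e (star A * A) ^ (1 / 2 : ℝ)

/-- The complex conjugate `∑ⱼ conj ⟨x, eⱼ⟩ eⱼ` of `x` with respect to the real system `e`. -/
def conjugate (e : HilbertBasis ι ℂ H) (x : H) : H := e.repr.symm (star (e.repr x))

end Operators

/-! ### Second-order stationary processes -/

section Covariance

variable {H : Type*} [NormedAddCommGroup H] [InnerProductSpace ℂ H] [CompleteSpace H]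
variable {ι Ω : Type*} [MeasurableSpace Ω] {d : ℕ}

/-- The covariance operator `C(t, s) = 𝔼[X(t) ⊗ X(s)]`, where `(x ⊗ y) z = ⟨z, y⟩ x` with the
inner product linear in its first slot, which is `InnerProductSpace.rankOne ℂ x y`. -/
def covOp (X : E d → Ω → H) (μ : Measure Ω) (t s : E d) : H →L[ℂ] H :=
  ∫ ω, InnerProductSpace.rankOne ℂ (X t ω) (X s ω) ∂μ

/-- The pseudo-covariance operator `𝔼[X(t) ⊗ conj X(s)]`. -/
def pseudoCovOp (e : HilbertBasis ι ℂ H) (X : E d → Ω → H) (μ : Measure Ω) (t s : E d) :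
    H →L[ℂ] H :=
  ∫ ω, InnerProductSpace.rankOne ℂ (X t ω) (conjugate e (X s ω)) ∂μ

/-- `X` is a zero-mean second-order stationary process with values in `H`: second moments are
finite, and covariance and pseudo-covariance depend only on the lag. -/
structure IsSecondOrderStationary (e : HilbertBasis ι ℂ H) (X : E d → Ω → H) (μ : Measure Ω) :
    Prop where
  memLp : ∀ t, MemLp (X t) 2 μ
  mean_zero : ∀ t, ∫ ω, X t ω ∂μ = 0
  cov_lag : ∀ t s t' s', t - s = t' - s' → covOp X μ t s = covOp X μ t' s'
  pseudoCov_lag : ∀ t s t' s', t - s = t' - s' → pseudoCovOp e X μ t s = pseudoCovOp e X μ t' s'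

/-- `X` is real with respect to the system `e`. -/
def IsRealProcess (e : HilbertBasis ι ℂ H) (X : E d → Ω → H) (μ : Measure Ω) : Prop :=
  ∀ t, ∀ᵐ ω ∂μ, conjugate e (X t ω) = X t ω

/-- The stationary covariance operator `C(h) = C(0 + h, 0)`. -/
def statCov (X : E d → Ω → H) (μ : Measure Ω) (h : E d) : H →L[ℂ] H := covOp X μ h 0

/-- The oscillation `sup_{y : ‖x - y‖ ≤ δ} ‖C(y) - C(x)‖_tr`. -/
def oscTr (e : HilbertBasis ι ℂ H) (C : E d → H →L[ℂ] H) (δ : ℝ) (x : E d) : ℝ≥0∞ :=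
  ⨆ (y : E d) (_ : ‖x - y‖ ≤ δ), traceNorm e (C y - C x)

/-- The condition on the covariance: `C` is integrable in trace norm and `L¹`-`γ`-Hölder. -/
structure CovarianceCondition (e : HilbertBasis ι ℂ H) (C : E d → H →L[ℂ] H) (γ : ℝ) : Prop where
  aestronglyMeasurable : AEStronglyMeasurable C volume
  integrable : ∫⁻ h, traceNorm e (C h) < ∞
  gamma_pos : 0 < γ
  gamma_le_one : γ ≤ 1
  holder : ∃ M : ℝ, ∀ δ : ℝ, 0 < δ → δ < 1 →
    AEMeasurable (oscTr e C δ) volume ∧ ∫⁻ x, oscTr e C δ x ≤ ENNReal.ofReal (M * δ ^ γ)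

/-- The character `exp(i h^⊤ θ)`. -/
def character (h θ : E d) : ℂ := Complex.exp (Complex.I * ((inner ℝ h θ : ℝ) : ℂ))

/-- The spectral density `f(θ) = (2π)^{-d} ∫ exp(i h^⊤ θ) C(h) dh`. -/
def spectralDensity (C : E d → H →L[ℂ] H) (θ : E d) : H →L[ℂ] H :=
  (((2 * Real.pi) ^ d)⁻¹ : ℝ) • ∫ h, character h θ • C h

end Covariance

/-! ### Sampling design -/

section Sampling

variable {d : ℕ}

/-- The sampling region: the closed convex hull of the observed locations. -/
def region {n : ℕ} (t : Fin n → E d) : Set (E d) := closure (convexHull ℝ (Set.range t))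

/-- The Lebesgue measure `|A|` as a real number. -/
def vol (A : Set (E d)) : ℝ := (volume A).toReal

/-- The Voronoi cell of `t i` in the sampling region. -/
def cell {n : ℕ} (t : Fin n → E d) (i : Fin n) : Set (E d) :=
  {x | x ∈ region t ∧ ∀ j, ‖x - t i‖ ≤ ‖x - t j‖}

/-- The diameter of the tessellation: `max_i sup_{x ∈ V(t_i)} ‖x - t_i‖`. -/
def meshSize {n : ℕ} (t : Fin n → E d) : ℝ :=
  sSup {r | ∃ i, ∃ x ∈ cell t i, r = ‖x - t i‖}

/-- The sampling condition for a triangular array of distinct locations `t n i`, `i = 1, …, n`: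
the mesh size tends to `0`, the volume of the sampling region tends to infinity, and the sampling
region, rescaled to unit volume, converges in the Hausdorff metric to a fixed bounded convex set
with nonempty interior. -/
structure SamplingCondition (t : (n : ℕ) → Fin n → E d) : Prop where
  distinct : ∀ n, Function.Injective (t n)
  mesh : Tendsto (fun n => meshSize (t n)) atTop (𝓝 0)
  volume_region : Tendsto (fun n => vol (region (t n))) atTop atTop
  shape : ∃ T : Set (E d), Bornology.IsBounded T ∧ Convex ℝ T ∧ (interior T).Nonempty ∧
    Tendsto (fun n => Metric.hausdorffEDist
      ((vol (region (t n)) ^ (1 / (d : ℝ)))⁻¹ • region (t n)) T) atTop (𝓝 0)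

end Sampling

/-! ### The kernel and the estimator -/

section Estimator

variable {d : ℕ}

/-- `S_K = {t : K(t) > 0}`. -/
def posSet (K : E d → ℝ) : Set (E d) := {u | 0 < K u}

/-- The condition on the kernel. -/
structure KernelCondition (K : E d → ℝ) : Prop where
  continuous : Continuous K
  nonneg : ∀ u, 0 ≤ K u
  bounded_support : Bornology.IsBounded (posSet K)
  zero_mem : (0 : E d) ∈ posSet K
  le_at_zero : ∀ u, K u ≤ K 0
  at_zero : K 0 = 1
  gradient_bound : ∃ ε : ℝ, 0 < ε ∧ (∀ u, ‖u‖ < ε → DifferentiableAt ℝ K u) ∧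
    ∃ M : ℝ, ∀ u, ‖u‖ < ε → ‖gradient K u‖ ≤ M

variable {H : Type*} [NormedAddCommGroup H] [InnerProductSpace ℂ H] [CompleteSpace H]
variable {ι Ω : Type*} [MeasurableSpace Ω]

/-- The estimator
`(2π)^{-d} ∑_{t,s} exp(i (t-s)^⊤ θ) (X(t) ⊗ X(s)) / |T ∩ (T - (t-s))| K((t-s)/Δ) |V(t)| |V(s)|`
based on the observations at `t 1, …, t n`, evaluated at the outcome `ω`. -/
def estimator (X : E d → Ω → H) (K : E d → ℝ) {n : ℕ} (t : Fin n → E d) (Δ : ℝ) (θ : E d)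
    (ω : Ω) : H →L[ℂ] H :=
  (((2 * Real.pi) ^ d)⁻¹ : ℝ) • ∑ i, ∑ j,
    (character (t i - t j) θ *
      ((K (Δ⁻¹ • (t i - t j)) * vol (cell t i) * vol (cell t j) /
        vol (region t ∩ (fun x => x - (t i - t j)) '' region t) : ℝ) : ℂ)) •
      InnerProductSpace.rankOne ℂ (X (t i) ω) (X (t j) ω)

/-- `B₁(Δ) = ‖∫_{h ∈ Δ S_K} exp(i h^⊤ θ) C(h) (1 - K(h/Δ)) dh‖_HS`. -/
def biasOne (e : HilbertBasis ι ℂ H) (C : E d → H →L[ℂ] H) (K : E d → ℝ) (Δ : ℝ) (θ : E d) :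
    ℝ≥0∞ :=
  hsNorm e (∫ h in Δ • posSet K, (character h θ * ((1 - K (Δ⁻¹ • h) : ℝ) : ℂ)) • C h)

/-- `B₂(Δ) = ‖∫_{h ∉ Δ S_K} exp(i h^⊤ θ) C(h) dh‖_HS`. -/
def biasTwo (e : HilbertBasis ι ℂ H) (C : E d → H →L[ℂ] H) (K : E d → ℝ) (Δ : ℝ) (θ : E d) :
    ℝ≥0∞ :=
  hsNorm e (∫ h in (Δ • posSet K)ᶜ, character h θ • C h)

end Estimator

end SpectralBias

end

/-!
The expectation of the estimator is a Riemann sum, over products of Voronoi cells, for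
`∬_{T × T} g (x - y) dx dy = ∫ |T ∩ (T - h)| g(h) dh`, where `g(h)` is the covariance `C(h)` times
the character and the kernel, divided by the overlap `|T ∩ (T - h)|`, so the overlap cancels in the
limit. The quadrature error is governed by the L¹ modulus of continuity of `C` and by the Lipschitz
continuity of the other factors of `g`. For the overlap this is convexity: if `T` contains a ball of
radius `ρ`, then `T ∪ (T + u)` lies in a dilate of `T` by `1 + ‖u‖ / ρ`, so the overlap varies by at
most a constant multiple of `|T| ‖h - h'‖ / ρ`, and it stays comparable to `|T|` on the support of
the kernel because `Δₙ` is of smaller order than `ρ`.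

Estimates of norms of vectors suffice: the Hilbert-Schmidt norm is the supremum of the norms of the
restrictions `A ↦ (A e_j)_{j ∈ J}` to finite sets `J` of basis vectors, which are bounded linear
maps into Hilbert spaces dominated by the trace norm.

What remains after passing to the limit is the bias of tapering `C` by `K(·/Δ)`, and that is, up to
sign, the sum of the integrals in `B₁` and `B₂`.
-/

namespace SpectralBias

section HilbertSchmidt

variable {H : Type*} [NormedAddCommGroup H] [InnerProductSpace ℂ H]
variable {ι : Type*} (e : HilbertBasis ι ℂ H)

theorem tsum_enorm_inner_sq (x : H) : ∑' j, ‖inner ℂ (e j) x‖ₑ ^ 2 = ‖x‖ₑ ^ 2 := by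
  have hsum : HasSum (fun j => ‖inner ℂ (e j) x‖ ^ 2) (‖x‖ ^ 2) := by
    simpa [e.repr_apply_apply] using lp.hasSum_norm (p := 2) (by norm_num) (e.repr x)
  have htsum := ENNReal.ofReal_tsum_of_nonneg (fun j => sq_nonneg ‖inner ℂ (e j) x‖) hsum.summable
  rw [hsum.tsum_eq] at htsum
  simpa [ENNReal.ofReal_pow, ofReal_norm] using htsum.symm

/-- The restriction of an operator to finitely many vectors of the basis, as an element of a
Hilbert space. The Hilbert-Schmidt norm is the supremum of the norms of these restrictions, which
carries estimates in Banach spaces over to the Hilbert-Schmidt norm. -/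
noncomputable def basisValues (S : Finset ι) : (H →L[ℂ] H) →L[ℂ] PiLp 2 (fun _ : S => H) :=
  (PiLp.continuousLinearEquiv 2 ℂ (fun _ : S => H)).symm.toContinuousLinearMap ∘L
    ContinuousLinearMap.pi fun j => ContinuousLinearMap.apply ℂ H (e j)

theorem enorm_basisValues_sq (S : Finset ι) (A : H →L[ℂ] H) :
    ‖basisValues e S A‖ₑ ^ 2 = ∑ j ∈ S, ‖A (e j)‖ₑ ^ 2 := by
  have h := congrArg ENNReal.ofReal
    (PiLp.norm_sq_eq_of_L2 (fun _ : S => H) (basisValues e S A))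
  rw [ENNReal.ofReal_sum_of_nonneg fun _ _ => by positivity] at h
  simp only [ENNReal.ofReal_pow, norm_nonneg, ofReal_norm] at h
  rw [h, ← Finset.sum_coe_sort S fun j => ‖A (e j)‖ₑ ^ 2]
  rfl

variable [CompleteSpace H]

theorem hsNorm_sq (A : H →L[ℂ] H) : hsNorm e A ^ 2 = ∑' j, ‖A (e j)‖ₑ ^ 2 := by
  have hterm (j : ι) : RCLike.re (inner ℂ (e j) ((star A * A) (e j))) = ‖A (e j)‖ ^ 2 := by
    rw [mul_apply_eq_comp, ContinuousLinearMap.star_eq_adjoint,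
      ContinuousLinearMap.adjoint_inner_right, inner_self_eq_norm_sq]
  rw [hsNorm, ← ENNReal.rpow_natCast, ← ENNReal.rpow_mul, traceNorm,
    CFC.abs_of_nonneg (star A * A) (star_mul_self_nonneg A)]
  simp only [hterm, norm_nonneg, ENNReal.ofReal_pow, ofReal_norm]
  norm_num

theorem hsNorm_eq_iSup (A : H →L[ℂ] H) : hsNorm e A = ⨆ S, ‖basisValues e S A‖ₑ := by
  refine le_antisymm ?_ (iSup_le fun S => ?_) <;>
    rw [← ENNReal.pow_le_pow_left_iff two_ne_zero, hsNorm_sq]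
  · rw [ENNReal.tsum_eq_iSup_sum]
    refine iSup_le fun S => ?_
    rw [← enorm_basisValues_sq]
    exact pow_le_pow_left' (le_iSup (fun S => ‖basisValues e S A‖ₑ) S) 2
  · rw [enorm_basisValues_sq]
    exact ENNReal.sum_le_tsum S

theorem enorm_basisValues_le (S : Finset ι) (A : H →L[ℂ] H) :
    ‖basisValues e S A‖ₑ ≤ hsNorm e A :=
  (le_iSup (fun S => ‖basisValues e S A‖ₑ) S).trans (hsNorm_eq_iSup e A).ge

theorem hsNorm_le_of_forall_enorm_basisValues_le {A : H →L[ℂ] H} {b : ℝ≥0∞}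
    (h : ∀ S, ‖basisValues e S A‖ₑ ≤ b) : hsNorm e A ≤ b :=
  (hsNorm_eq_iSup e A).trans_le (iSup_le h)

theorem hsNorm_add_le (A B : H →L[ℂ] H) : hsNorm e (A + B) ≤ hsNorm e A + hsNorm e B :=
  hsNorm_le_of_forall_enorm_basisValues_le e fun S => by
    rw [map_add]
    exact (enorm_add_le _ _).trans
      (add_le_add (enorm_basisValues_le e S A) (enorm_basisValues_le e S B))

theorem hsNorm_neg (A : H →L[ℂ] H) : hsNorm e (-A) = hsNorm e A := by
  simp [hsNorm]

theorem hsNorm_smul_le (c : ℝ) (A : H →L[ℂ] H) : hsNorm e (c • A) ≤ ‖c‖ₑ * hsNorm e A :=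
  hsNorm_le_of_forall_enorm_basisValues_le e fun S => by
    rw [← Complex.coe_smul, map_smul, enorm_smul, ← ofReal_norm (c : ℂ), Complex.norm_real,
      ofReal_norm]
    gcongr
    exact enorm_basisValues_le e S A

theorem enorm_adjoint_apply_le (A : H →L[ℂ] H) (y : H) :
    ‖ContinuousLinearMap.adjoint A y‖ₑ ≤ hsNorm e A * ‖y‖ₑ := by
  rw [← ENNReal.pow_le_pow_left_iff two_ne_zero, mul_pow, hsNorm_sq, ← ENNReal.tsum_mul_right,
    ← tsum_enorm_inner_sq e]
  refine ENNReal.tsum_le_tsum fun j => ?_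
  rw [ContinuousLinearMap.adjoint_inner_right, ← mul_pow]
  refine pow_le_pow_left' ?_ 2
  simp only [← ofReal_norm, ← ENNReal.ofReal_mul (norm_nonneg _)]
  exact ENNReal.ofReal_le_ofReal (norm_inner_le_norm _ _)

theorem enorm_le_hsNorm (A : H →L[ℂ] H) : ‖A‖ₑ ≤ hsNorm e A := by
  rcases eq_or_ne (hsNorm e A) ∞ with htop | htop
  · simp [htop]
  rw [← ofReal_norm, ← LinearIsometryEquiv.norm_map ContinuousLinearMap.adjoint A]
  refine ENNReal.ofReal_le_of_le_toReal <|
    ContinuousLinearMap.opNorm_le_bound _ ENNReal.toReal_nonneg fun y => ?_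
  simpa using ENNReal.toReal_mono (ENNReal.mul_ne_top htop enorm_ne_top)
    (enorm_adjoint_apply_le e A y)

theorem hsNorm_mul_le (A B : H →L[ℂ] H) : hsNorm e (A * B) ≤ hsNorm e A * hsNorm e B := by
  rw [← ENNReal.pow_le_pow_left_iff two_ne_zero, mul_pow, hsNorm_sq, hsNorm_sq e B,
    ← ENNReal.tsum_mul_left]
  refine ENNReal.tsum_le_tsum fun j => ?_
  rw [← mul_pow]
  exact pow_le_pow_left'
    ((A.le_opENorm (B (e j))).trans (mul_le_mul_left (enorm_le_hsNorm e A) _)) 2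

theorem hsNorm_abs (A : H →L[ℂ] H) : hsNorm e (CFC.abs A) = hsNorm e A := by
  rw [hsNorm, hsNorm, (IsSelfAdjoint.of_nonneg (CFC.abs_nonneg A)).star_eq, CFC.abs_mul_abs]

theorem hsNorm_sqrt_abs_mul_self (A : H →L[ℂ] H) :
    hsNorm e (CFC.sqrt (CFC.abs A)) * hsNorm e (CFC.sqrt (CFC.abs A)) = traceNorm e A := by
  rw [← sq, hsNorm, ← ENNReal.rpow_natCast, ← ENNReal.rpow_mul,
    (IsSelfAdjoint.of_nonneg (CFC.sqrt_nonneg (CFC.abs A))).star_eq,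
    CFC.sqrt_mul_sqrt_self _ (CFC.abs_nonneg A)]
  simp [traceNorm, CFC.cfcAbs_cfcAbs]

theorem hsNorm_le_traceNorm (A : H →L[ℂ] H) : hsNorm e A ≤ traceNorm e A :=
  calc hsNorm e A
      = hsNorm e (CFC.sqrt (CFC.abs A) * CFC.sqrt (CFC.abs A)) := by
        rw [CFC.sqrt_mul_sqrt_self _ (CFC.abs_nonneg A), hsNorm_abs]
    _ ≤ hsNorm e (CFC.sqrt (CFC.abs A)) * hsNorm e (CFC.sqrt (CFC.abs A)) := hsNorm_mul_le e _ _
    _ = traceNorm e A := hsNorm_sqrt_abs_mul_self e A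

end HilbertSchmidt

section Overlap

variable {V : Type*} [AddCommGroup V] {T : Set V}

theorem mem_inter_neg_vadd_set {h x : V} : x ∈ T ∩ (-h +ᵥ T) ↔ x ∈ T ∧ h + x ∈ T := by
  rw [Set.mem_inter_iff, Set.mem_vadd_set_iff_neg_vadd_mem, neg_neg, vadd_eq_add]

variable [MeasurableSpace V] (μ : Measure V)

/-- The measure of `T ∩ (T - h)`, by which the estimator normalises the observations at lag `h`. -/
noncomputable def overlap (T : Set V) (h : V) : ℝ := μ.real (T ∩ (-h +ᵥ T))

theorem overlap_zero (T : Set V) : overlap μ T 0 = μ.real T := by simp [overlap]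

theorem measurableSet_inter_neg_vadd [MeasurableAdd V] (hm : MeasurableSet T) (h : V) :
    MeasurableSet (T ∩ (-h +ᵥ T)) := hm.inter (hm.const_vadd (-h))

variable [MeasurableAdd₂ V]

theorem measurableSet_prod_inter_neg_vadd (hm : MeasurableSet T) :
    MeasurableSet {z : V × V | z.1 ∈ T ∩ (-z.2 +ᵥ T)} := by
  simp only [mem_inter_neg_vadd_set]
  exact (measurable_fst hm).inter ((measurable_snd.add measurable_fst) hm)

theorem measurable_overlap [SFinite μ] (hm : MeasurableSet T) : Measurable (overlap μ T) :=
  (measurable_measure_prodMk_right (measurableSet_prod_inter_neg_vadd hm)).ennreal_toReal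

end Overlap

section ConvexOverlap

variable {V : Type*} [NormedAddCommGroup V] [NormedSpace ℝ V]

theorem one_add_pow_le_one_add_two_pow_mul {ε : ℝ} (hε : 0 ≤ ε) (hε1 : ε ≤ 1) (m : ℕ) :
    (1 + ε) ^ m ≤ 1 + 2 ^ m * ε := by
  have hconv := (convexOn_pow m).2 (Set.mem_Ici.2 zero_le_one) (Set.mem_Ici.2 zero_le_two)
    (sub_nonneg.2 hε1) hε (sub_add_cancel 1 ε)
  simp only [smul_eq_mul, one_pow, mul_one] at hconv
  calc (1 + ε) ^ m = (1 - ε + ε * 2) ^ m := by ring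
    _ ≤ 1 - ε + ε * 2 ^ m := hconv
    _ ≤ 1 + 2 ^ m * ε := by linarith

theorem add_mem_homothety_image {T : Set V} (hT : Convex ℝ T) {x₀ u y : V} {ρ ε : ℝ} (hρ : 0 ≤ ρ)
    (hball : Metric.closedBall x₀ ρ ⊆ T) (hε : 0 ≤ ε) (hu : ‖u‖ ≤ ε * ρ) (hy : y ∈ T) :
    u + y ∈ AffineMap.homothety x₀ (1 + ε) '' T := by
  have hεu : ε • ε⁻¹ • u = u := by
    rcases eq_or_ne ε 0 with rfl | hε0
    · simpa [eq_comm] using hu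
    · exact smul_inv_smul₀ hε0 u
  have hv : x₀ + ε⁻¹ • u ∈ T := hball <| by
    rw [mem_closedBall_iff_norm, add_sub_cancel_left, norm_smul, norm_inv, Real.norm_of_nonneg hε]
    exact inv_mul_le_of_le_mul₀ hε hρ hu
  have hε1 : 0 < 1 + ε := by positivity
  refine ⟨(1 + ε)⁻¹ • y + (ε * (1 + ε)⁻¹) • (x₀ + ε⁻¹ • u),
    hT hy hv (by positivity) (by positivity) (by field_simp), ?_⟩
  rw [AffineMap.homothety_apply, vsub_eq_sub, vadd_eq_add, smul_sub, smul_add, smul_smul,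
    smul_smul, mul_inv_cancel₀ hε1.ne', mul_left_comm, mul_inv_cancel₀ hε1.ne', mul_one, one_smul,
    smul_add, hεu, add_smul, one_smul]
  abel

variable [MeasurableSpace V] [BorelSpace V] [FiniteDimensional ℝ V] {μ : Measure V}
variable [μ.IsAddHaarMeasure] {T : Set V} {x₀ : V} {ρ : ℝ}

theorem measureReal_vadd_sdiff_le (hT : Convex ℝ T) (hm : MeasurableSet T) (hfin : μ T ≠ ∞)
    (hρ : 0 < ρ) (hball : Metric.closedBall x₀ ρ ⊆ T) {u : V} (hu : ‖u‖ ≤ ρ) :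
    μ.real ((u +ᵥ T) \ T) ≤ 2 ^ Module.finrank ℝ V * (‖u‖ / ρ) * μ.real T := by
  set ε := ‖u‖ / ρ
  have hε0 : 0 ≤ ε := by positivity
  have hsub : (u +ᵥ T) ∪ T ⊆ AffineMap.homothety x₀ (1 + ε) '' T := by
    rintro _ (⟨y, hy, rfl⟩ | hy)
    · exact add_mem_homothety_image hT hρ.le hball hε0 (div_mul_cancel₀ _ hρ.ne').ge hy
    · simpa using add_mem_homothety_image hT hρ.le hball hε0 (u := 0)
        (by rw [norm_zero]; positivity) hy
  have himage : μ.real (AffineMap.homothety x₀ (1 + ε) '' T) =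
      (1 + ε) ^ Module.finrank ℝ V * μ.real T := by
    rw [measureReal_def, Measure.addHaar_image_homothety, ENNReal.toReal_mul,
      ENNReal.toReal_ofReal (abs_nonneg _), abs_of_nonneg (by positivity), measureReal_def]
  have himage_fin : μ (AffineMap.homothety x₀ (1 + ε) '' T) ≠ ∞ := by
    rw [Measure.addHaar_image_homothety]
    exact ENNReal.mul_ne_top ENNReal.ofReal_ne_top hfin
  have hvadd_fin : μ (u +ᵥ T) ≠ ∞ := by rwa [measure_vadd]
  have hsum : μ.real ((u +ᵥ T) \ T) + μ.real T ≤ (1 + ε) ^ Module.finrank ℝ V * μ.real T := by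
    rw [← himage, ← measureReal_union Set.disjoint_sdiff_left hm
      (measure_ne_top_of_subset Set.sdiff_subset hvadd_fin) hfin, Set.sdiff_union_self]
    exact measureReal_mono hsub himage_fin
  have hpow := mul_le_mul_of_nonneg_right
    (one_add_pow_le_one_add_two_pow_mul hε0 ((div_le_one₀ hρ).2 hu) (Module.finrank ℝ V))
    (measureReal_nonneg (μ := μ) (s := T))
  linarith

theorem overlap_sub_le (hT : Convex ℝ T) (hm : MeasurableSet T) (hfin : μ T ≠ ∞) (hρ : 0 < ρ)
    (hball : Metric.closedBall x₀ ρ ⊆ T) {h h' : V} (hh : ‖h' - h‖ ≤ ρ) :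
    overlap μ T h - overlap μ T h' ≤ 2 ^ Module.finrank ℝ V * (‖h' - h‖ / ρ) * μ.real T := by
  have htranslate : (-h +ᵥ T) \ (-h' +ᵥ T) = -h' +ᵥ (((h' - h) +ᵥ T) \ T) := by
    rw [Set.vadd_set_sdiff, vadd_vadd, neg_add_eq_sub, sub_sub_cancel_left]
  have hsub : (T ∩ (-h +ᵥ T)) \ (T ∩ (-h' +ᵥ T)) ⊆ (-h +ᵥ T) \ (-h' +ᵥ T) :=
    fun x hx => ⟨hx.1.2, fun hx' => hx.2 ⟨hx.1.1, hx'⟩⟩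
  have hvadd_fin : μ ((-h +ᵥ T) \ (-h' +ᵥ T)) ≠ ∞ :=
    measure_ne_top_of_subset Set.sdiff_subset (by rwa [measure_vadd])
  calc overlap μ T h - overlap μ T h'
      ≤ μ.real ((T ∩ (-h +ᵥ T)) \ (T ∩ (-h' +ᵥ T))) :=
        le_measureReal_sdiff (measure_ne_top_of_subset Set.inter_subset_left hfin)
    _ ≤ μ.real ((-h +ᵥ T) \ (-h' +ᵥ T)) := measureReal_mono hsub hvadd_fin
    _ = μ.real (((h' - h) +ᵥ T) \ T) := by rw [htranslate, measureReal_def, measure_vadd]; rfl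
    _ ≤ _ := measureReal_vadd_sdiff_le hT hm hfin hρ hball hh

theorem abs_overlap_sub_le (hT : Convex ℝ T) (hm : MeasurableSet T) (hfin : μ T ≠ ∞) (hρ : 0 < ρ)
    (hball : Metric.closedBall x₀ ρ ⊆ T) {h h' : V} (hh : ‖h' - h‖ ≤ ρ) :
    |overlap μ T h' - overlap μ T h| ≤ 2 ^ Module.finrank ℝ V * (‖h' - h‖ / ρ) * μ.real T := by
  refine abs_sub_le_iff.2 ⟨?_, overlap_sub_le hT hm hfin hρ hball hh⟩
  rw [norm_sub_rev] at hh ⊢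
  exact overlap_sub_le hT hm hfin hρ hball hh

theorem half_le_overlap (hT : Convex ℝ T) (hm : MeasurableSet T) (hfin : μ T ≠ ∞) (hρ : 0 < ρ)
    (hball : Metric.closedBall x₀ ρ ⊆ T) {h : V}
    (hh : 2 ^ (Module.finrank ℝ V + 1) * ‖h‖ ≤ ρ) : μ.real T / 2 ≤ overlap μ T h := by
  have hle : ‖h - 0‖ ≤ ρ := by
    rw [sub_zero]
    exact (le_mul_of_one_le_left (norm_nonneg h) (one_le_pow₀ one_le_two)).trans hh
  have hsub := (abs_sub_le_iff.1 (abs_overlap_sub_le hT hm hfin hρ hball hle)).2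
  have hratio : 2 ^ Module.finrank ℝ V * (‖h‖ / ρ) ≤ 1 / 2 := by
    rw [← mul_div_assoc, div_le_iff₀ hρ]
    rw [pow_succ] at hh
    linarith
  have hmul := mul_le_mul_of_nonneg_right hratio (measureReal_nonneg (μ := μ) (s := T))
  rw [sub_zero, overlap_zero] at hsub
  linarith

end ConvexOverlap

section HausdorffDistance

variable {V : Type*} [NormedAddCommGroup V] [InnerProductSpace ℝ V] [CompleteSpace V]

theorem closedBall_subset_of_hausdorffEDist_lt {S T : Set V} (hS : Convex ℝ S) (hc : IsClosed S)
    {x₀ : V} {r : ℝ} (hr : 0 < r) (hball : Metric.closedBall x₀ (2 * r) ⊆ T)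
    (hd : Metric.hausdorffEDist S T < ENNReal.ofReal r) : Metric.closedBall x₀ r ⊆ S := by
  intro z hz
  by_contra hzS
  obtain ⟨f, c, hfc, hcz⟩ := geometric_hahn_banach_closed_point hS hc hzS
  obtain ⟨v, rfl⟩ := (InnerProductSpace.toDual ℝ V).surjective f
  simp only [InnerProductSpace.toDual_apply_apply] at hfc hcz
  -- Pushing `z` by `r` away from the separating hyperplane gives a point of `T` at distance more
  -- than `r` from `S`.
  have hpush : ‖(r / ‖v‖) • v‖ ≤ r := by
    rw [norm_smul, norm_div, norm_norm, Real.norm_of_nonneg hr.le,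
      div_mul_eq_mul_div, mul_div_assoc]
    exact mul_le_of_le_one_right hr.le (div_self_le_one _)
  have hpushT : z + (r / ‖v‖) • v ∈ T := by
    refine hball (mem_closedBall_iff_norm.2 ?_)
    rw [add_sub_right_comm, two_mul]
    exact norm_add_le_of_le (mem_closedBall_iff_norm.1 hz) hpush
  rw [Metric.hausdorffEDist_comm] at hd
  obtain ⟨s, hs, hdist⟩ := Metric.exists_edist_lt_of_hausdorffEDist_lt hpushT hd
  rw [edist_dist, ENNReal.ofReal_lt_ofReal_iff hr, dist_eq_norm] at hdist
  have hsep : inner ℝ v s < inner ℝ v z := (hfc s hs).trans hcz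
  have hv : 0 < ‖v‖ := norm_pos_iff.2 (by rintro rfl; simp at hsep)
  have hcauchy : inner ℝ v z + ‖v‖ * r - inner ℝ v s ≤ ‖v‖ * ‖z + (r / ‖v‖) • v - s‖ := by
    convert real_inner_le_norm v (z + (r / ‖v‖) • v - s) using 1
    rw [inner_sub_right, inner_add_right, real_inner_smul_right, real_inner_self_eq_norm_sq]
    field_simp
  linarith [mul_lt_mul_of_pos_left hdist hv]

end HausdorffDistance

section LagIntegral

variable {V : Type*} [AddCommGroup V] [MeasurableSpace V] [MeasurableAdd₂ V]
variable {F : Type*} [NormedAddCommGroup F] {μ : Measure V} {T : Set V} {g : V → F}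

/-- The integrand of `∫_T ∫_T g(x - y) dx dy` in the coordinates `(y, x - y)`. -/
noncomputable def lagIntegrand (T : Set V) (g : V → F) : V × V → F :=
  {z : V × V | z.1 ∈ T ∩ (-z.2 +ᵥ T)}.indicator fun z => g z.2

theorem integrable_lagIntegrand [SFinite μ] (hm : MeasurableSet T) (hfin : μ T ≠ ∞)
    (hg : Integrable g μ) : Integrable (lagIntegrand T g) (μ.prod μ) := by
  rw [lagIntegrand, integrable_indicator_iff (measurableSet_prod_inter_neg_vadd hm)]
  have : IsFiniteMeasure (μ.restrict T) := ⟨by simpa using hfin.lt_top⟩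
  have hprod : IntegrableOn (fun z : V × V => g z.2) (T ×ˢ Set.univ) (μ.prod μ) := by
    rw [IntegrableOn, ← Measure.prod_restrict, Measure.restrict_univ]
    exact hg.comp_snd _
  exact hprod.mono_set fun z hz => ⟨hz.1, trivial⟩

variable [NormedSpace ℝ F]

theorem integral_lagIntegrand_left [μ.IsAddLeftInvariant] (hm : MeasurableSet T) (y : V) :
    ∫ h, lagIntegrand T g (y, h) ∂μ =
      T.indicator (fun y => ∫ x in T, g (x - y) ∂μ) y := by
  classical
  by_cases hy : y ∈ T
  · rw [Set.indicator_of_mem hy, ← integral_indicator hm,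
      ← integral_add_left_eq_self (T.indicator fun x => g (x - y)) y]
    congr 1 with h
    simp only [lagIntegrand, Set.indicator_apply, Set.mem_ofPred_eq, mem_inter_neg_vadd_set, hy,
      true_and, add_comm h y, add_sub_cancel_left]
  · simp [lagIntegrand, hy]

theorem integral_lagIntegrand_right [CompleteSpace F] (hm : MeasurableSet T) (h : V) :
    ∫ y, lagIntegrand T g (y, h) ∂μ = overlap μ T h • g h := by
  calc ∫ y, lagIntegrand T g (y, h) ∂μ
      = ∫ y, (T ∩ (-h +ᵥ T)).indicator (fun _ => g h) y ∂μ := rfl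
    _ = overlap μ T h • g h := by
      rw [integral_indicator (measurableSet_inter_neg_vadd hm h), setIntegral_const, overlap]

variable [SFinite μ] [μ.IsAddLeftInvariant]

theorem integrableOn_integral_sub (hm : MeasurableSet T) (hfin : μ T ≠ ∞) (hg : Integrable g μ) :
    IntegrableOn (fun y => ∫ x in T, g (x - y) ∂μ) T μ := by
  rw [← integrable_indicator_iff hm]
  simpa only [integral_lagIntegrand_left hm] using
    (integrable_lagIntegrand hm hfin hg).integral_prod_left

theorem setIntegral_setIntegral_sub [CompleteSpace F] (hm : MeasurableSet T) (hfin : μ T ≠ ∞)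
    (hg : Integrable g μ) :
    ∫ y in T, ∫ x in T, g (x - y) ∂μ ∂μ = ∫ h, overlap μ T h • g h ∂μ := by
  have hswap := integral_integral_swap (f := fun y h => lagIntegrand T g (y, h))
    (integrable_lagIntegrand hm hfin hg)
  simpa only [integral_lagIntegrand_left hm, integral_lagIntegrand_right hm,
    integral_indicator hm] using hswap

end LagIntegral

section Quadrature

variable {V : Type*} [MeasurableSpace V] {μ : Measure V} {T : Set V}
variable {F : Type*} [NormedAddCommGroup F] [NormedSpace ℝ F] [CompleteSpace F]
variable {κ : Type*} [Fintype κ] {P : κ → Set V}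

theorem enorm_sum_smul_sub_setIntegral_le (hP : μ.restrict T = .sum fun i => μ.restrict (P i))
    (hfin : μ T ≠ ∞) {f : V → F} (hf : IntegrableOn f T μ) (a : κ → F) :
    ‖∑ i, μ.real (P i) • a i - ∫ x in T, f x ∂μ‖ₑ ≤ ∑ i, ∫⁻ x in P i, ‖a i - f x‖ₑ ∂μ := by
  have hle (i : κ) : μ.restrict (P i) ≤ μ.restrict T := hP ▸ Measure.le_sum _ i
  have hfinP (i : κ) : μ (P i) ≠ ∞ := by
    simpa using ((hle i Set.univ).trans_lt (by simpa using hfin.lt_top)).ne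
  have hconst (i : κ) : ∫ _ in P i, a i ∂μ = μ.real (P i) • a i := setIntegral_const _
  have hfP (i : κ) : IntegrableOn f (P i) μ := Integrable.mono_measure hf (hle i)
  rw [hP, Measure.sum_fintype, integral_finsetSum_measure fun i _ => hfP i,
    ← Finset.sum_sub_distrib]
  refine (enorm_sum_le _ _).trans (Finset.sum_le_sum fun i _ => ?_)
  have hint : Integrable (fun _ => a i) (μ.restrict (P i)) := integrableOn_const (hfinP i)
  rw [← hconst, ← integral_sub hint (hfP i)]
  exact enorm_integral_le_lintegral_enorm _

end Quadrature

section LagQuadrature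

variable {V : Type*} [NormedAddCommGroup V] [MeasurableSpace V] [MeasurableAdd₂ V]
variable {F : Type*} [NormedAddCommGroup F] [NormedSpace ℝ F] [CompleteSpace F]
variable {μ : Measure V} [SFinite μ] [μ.IsAddLeftInvariant] {T : Set V} {g : V → F}
variable {κ : Type*} [Fintype κ] {P : κ → Set V} {p : κ → V} {δ : ℝ}

theorem enorm_sum_sum_smul_sub_integral_overlap_le (hm : MeasurableSet T) (hfin : μ T ≠ ∞)
    (hP : μ.restrict T = .sum fun i => μ.restrict (P i)) (hPm : ∀ i, MeasurableSet (P i))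
    (hp : ∀ i, ∀ x ∈ P i, ‖x - p i‖ ≤ δ) (hg : Integrable g μ) {b : V → ℝ≥0∞}
    (hb : ∀ h h', ‖h' - h‖ ≤ 2 * δ → ‖g h' - g h‖ₑ ≤ b h) :
    ‖∑ j, μ.real (P j) • ∑ i, μ.real (P i) • g (p i - p j) - ∫ h, overlap μ T h • g h ∂μ‖ₑ ≤
      μ T * ∫⁻ h, b h ∂μ := by
  have hlag {i j : κ} {x y : V} (hx : x ∈ P i) (hy : y ∈ P j) :
      ‖p i - p j - (x - y)‖ ≤ 2 * δ := by
    rw [sub_sub_sub_comm, two_mul]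
    refine norm_sub_le_of_le ?_ ?_ <;> rw [norm_sub_rev]
    exacts [hp i x hx, hp j y hy]
  have hinner (j : κ) (y : V) (hy : y ∈ P j) :
      ‖∑ i, μ.real (P i) • g (p i - p j) - ∫ x in T, g (x - y) ∂μ‖ₑ ≤ ∫⁻ h, b h ∂μ :=
    calc _ ≤ ∑ i, ∫⁻ x in P i, ‖g (p i - p j) - g (x - y)‖ₑ ∂μ :=
          enorm_sum_smul_sub_setIntegral_le hP hfin (hg.comp_sub_right y).integrableOn _
      _ ≤ ∑ i, ∫⁻ x in P i, b (x - y) ∂μ := Finset.sum_le_sum fun i _ =>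
          setLIntegral_mono' (hPm i) fun x hx => hb _ _ (hlag hx hy)
      _ = ∫⁻ x in T, b (x - y) ∂μ := by rw [hP, lintegral_sum_measure, tsum_fintype]
      _ ≤ ∫⁻ h, b h ∂μ :=
          (setLIntegral_le_lintegral T _).trans_eq (lintegral_sub_right_eq_self b y)
  rw [← setIntegral_setIntegral_sub hm hfin hg]
  calc _ ≤ ∑ j, ∫⁻ y in P j,
          ‖∑ i, μ.real (P i) • g (p i - p j) - ∫ x in T, g (x - y) ∂μ‖ₑ ∂μ :=
        enorm_sum_smul_sub_setIntegral_le hP hfin (integrableOn_integral_sub hm hfin hg) _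
    _ ≤ ∑ j, ∫⁻ _ in P j, (∫⁻ h, b h ∂μ) ∂μ := Finset.sum_le_sum fun j _ =>
        setLIntegral_mono' (hPm j) (hinner j)
    _ = ∫⁻ _ in T, (∫⁻ h, b h ∂μ) ∂μ := by rw [hP, lintegral_sum_measure, tsum_fintype]
    _ = μ T * ∫⁻ h, b h ∂μ := by rw [setLIntegral_const, mul_comm]

end LagQuadrature

section NormalisedQuadrature

theorem measureReal_pos_of_closedBall_subset {V : Type*} [PseudoMetricSpace V] [MeasurableSpace V]
    {μ : Measure V} [μ.IsOpenPosMeasure] {T : Set V} {x₀ : V} {ρ : ℝ} (hfin : μ T ≠ ∞) (hρ : 0 < ρ)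
    (hball : Metric.closedBall x₀ ρ ⊆ T) : 0 < μ.real T :=
  ENNReal.toReal_pos ((Metric.measure_closedBall_pos μ x₀ hρ).trans_le (measure_mono hball)).ne'
    hfin

variable {V : Type*} [NormedAddCommGroup V] [NormedSpace ℝ V] [MeasurableSpace V] [BorelSpace V]
  [FiniteDimensional ℝ V]
variable {F : Type*} [NormedAddCommGroup F] [NormedSpace ℝ F]
variable {μ : Measure V} [μ.IsAddHaarMeasure] {T : Set V} {G : V → F} {x₀ : V} {ρ R η : ℝ}

theorem norm_inv_smul_sub_inv_smul_le {a b c : ℝ} (hc : 0 < c) (ha : c ≤ a) (hb : c ≤ b) (x y : F) :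
    ‖b⁻¹ • y - a⁻¹ • x‖ ≤ c⁻¹ * (‖y - x‖ + c⁻¹ * |b - a| * ‖x‖) := by
  have ha0 := hc.trans_le ha
  have hb0 := hc.trans_le hb
  have hsplit : b⁻¹ • y - a⁻¹ • x = b⁻¹ • ((y - x) - (a⁻¹ * (b - a)) • x) := by
    have : b⁻¹ * (a⁻¹ * (b - a)) = a⁻¹ - b⁻¹ := by field_simp
    rw [smul_sub, smul_smul, this, smul_sub, sub_smul]
    abel
  rw [hsplit, norm_smul, norm_inv, Real.norm_of_nonneg hb0.le]
  gcongr
  refine norm_sub_le_of_le le_rfl ?_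
  rw [norm_smul, norm_mul, norm_inv, Real.norm_of_nonneg ha0.le, Real.norm_eq_abs]
  gcongr

theorem norm_inv_overlap_smul_sub_le (hT : Convex ℝ T) (hm : MeasurableSet T) (hfin : μ T ≠ ∞)
    (hρ : 0 < ρ) (hball : Metric.closedBall x₀ ρ ⊆ T)
    (hR : 2 ^ (Module.finrank ℝ V + 1) * (R + η) ≤ ρ) (hGR : ∀ h, R < ‖h‖ → G h = 0) {h h' : V}
    (hh : ‖h' - h‖ ≤ η) :
    ‖(overlap μ T h')⁻¹ • G h' - (overlap μ T h)⁻¹ • G h‖ ≤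
      (μ.real T / 2)⁻¹ *
        (‖G h' - G h‖ + 2 ^ (Module.finrank ℝ V + 1) * (η / ρ) * ‖G h‖) := by
  have hη : 0 ≤ η := (norm_nonneg _).trans hh
  have hv := measureReal_pos_of_closedBall_subset hfin hρ hball
  by_cases hout : R < ‖h‖ ∧ R < ‖h'‖
  · simp [hGR _ hout.1, hGR _ hout.2]
  have hnear : ‖h‖ ≤ R + η ∧ ‖h'‖ ≤ R + η := by
    have := abs_le.1 ((abs_norm_sub_norm_le h' h).trans hh)
    grind
  have hR0 : 0 ≤ R := by
    by_contra! hneg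
    exact hout ⟨hneg.trans_le (norm_nonneg h), hneg.trans_le (norm_nonneg h')⟩
  have hlower {k : V} (hk : ‖k‖ ≤ R + η) : μ.real T / 2 ≤ overlap μ T k :=
    half_le_overlap hT hm hfin hρ hball (le_trans (by gcongr) hR)
  have hηρ : η ≤ ρ :=
    calc η ≤ R + η := le_add_of_nonneg_left hR0
      _ ≤ 2 ^ (Module.finrank ℝ V + 1) * (R + η) :=
        le_mul_of_one_le_left (add_nonneg hR0 hη) (one_le_pow₀ one_le_two)
      _ ≤ ρ := hR
  have hlip : |overlap μ T h' - overlap μ T h| ≤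
      2 ^ Module.finrank ℝ V * (η / ρ) * μ.real T :=
    (abs_overlap_sub_le hT hm hfin hρ hball (hh.trans hηρ)).trans (by gcongr)
  refine (norm_inv_smul_sub_inv_smul_le (half_pos hv) (hlower hnear.1) (hlower hnear.2)
    _ _).trans ?_
  have hratio : (μ.real T / 2)⁻¹ * |overlap μ T h' - overlap μ T h| ≤
      2 ^ (Module.finrank ℝ V + 1) * (η / ρ) :=
    calc _ ≤ (μ.real T / 2)⁻¹ * (2 ^ Module.finrank ℝ V * (η / ρ) * μ.real T) := by gcongr
      _ = 2 ^ (Module.finrank ℝ V + 1) * (η / ρ) := by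
        rw [pow_succ]
        field_simp
  gcongr

theorem integrable_inv_overlap_smul (hT : Convex ℝ T) (hm : MeasurableSet T) (hfin : μ T ≠ ∞)
    (hρ : 0 < ρ) (hball : Metric.closedBall x₀ ρ ⊆ T)
    (hR : 2 ^ (Module.finrank ℝ V + 1) * R ≤ ρ) (hGR : ∀ h, R < ‖h‖ → G h = 0)
    (hG : Integrable G μ) : Integrable (fun h => (overlap μ T h)⁻¹ • G h) μ := by
  have hv := measureReal_pos_of_closedBall_subset hfin hρ hball
  refine (hG.norm.const_mul (μ.real T / 2)⁻¹).mono'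
    ((measurable_overlap μ hm).inv.aestronglyMeasurable.smul hG.aestronglyMeasurable)
    (ae_of_all _ fun h => ?_)
  rcases lt_or_ge R ‖h‖ with hh | hh
  · simp [hGR h hh]
  have hlower : μ.real T / 2 ≤ overlap μ T h :=
    half_le_overlap hT hm hfin hρ hball (le_trans (by gcongr) hR)
  rw [norm_smul, norm_inv, Real.norm_of_nonneg ((half_pos hv).le.trans hlower)]
  gcongr

theorem overlap_smul_inv_overlap_smul (hT : Convex ℝ T) (hm : MeasurableSet T) (hfin : μ T ≠ ∞)
    (hρ : 0 < ρ) (hball : Metric.closedBall x₀ ρ ⊆ T)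
    (hR : 2 ^ (Module.finrank ℝ V + 1) * R ≤ ρ) (hGR : ∀ h, R < ‖h‖ → G h = 0) (h : V) :
    overlap μ T h • (overlap μ T h)⁻¹ • G h = G h := by
  rcases lt_or_ge R ‖h‖ with hh | hh
  · simp [hGR h hh]
  have hlower : μ.real T / 2 ≤ overlap μ T h :=
    half_le_overlap hT hm hfin hρ hball (le_trans (by gcongr) hR)
  exact smul_inv_smul₀
    ((half_pos (measureReal_pos_of_closedBall_subset hfin hρ hball)).trans_le hlower).ne' _

theorem enorm_sum_sum_div_overlap_smul_sub_integral_le [CompleteSpace F] (hT : Convex ℝ T)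
    (hm : MeasurableSet T) (hfin : μ T ≠ ∞) (hρ : 0 < ρ) (hball : Metric.closedBall x₀ ρ ⊆ T)
    {κ : Type*} [Fintype κ] {P : κ → Set V} {p : κ → V} {δ : ℝ} (hδ : 0 ≤ δ)
    (hP : μ.restrict T = .sum fun i => μ.restrict (P i)) (hPm : ∀ i, MeasurableSet (P i))
    (hp : ∀ i, ∀ x ∈ P i, ‖x - p i‖ ≤ δ)
    (hR : 2 ^ (Module.finrank ℝ V + 1) * (R + 2 * δ) ≤ ρ) (hGR : ∀ h, R < ‖h‖ → G h = 0)
    (hG : Integrable G μ) {b : V → ℝ≥0∞}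
    (hb : ∀ h h', ‖h' - h‖ ≤ 2 * δ → ‖G h' - G h‖ₑ ≤ b h) :
    ‖∑ i, ∑ j, (μ.real (P i) * μ.real (P j) / overlap μ T (p i - p j)) • G (p i - p j) -
        ∫ h, G h ∂μ‖ₑ ≤
      2 * ∫⁻ h, (b h +
        ENNReal.ofReal (2 ^ (Module.finrank ℝ V + 1) * (2 * δ / ρ)) * ‖G h‖ₑ) ∂μ := by
  have hv := measureReal_pos_of_closedBall_subset hfin hρ hball
  have hR' : 2 ^ (Module.finrank ℝ V + 1) * R ≤ ρ := by
    refine le_trans ?_ hR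
    gcongr
    linarith
  have hsum : ∑ i, ∑ j, (μ.real (P i) * μ.real (P j) / overlap μ T (p i - p j)) • G (p i - p j) =
      ∑ j, μ.real (P j) • ∑ i, μ.real (P i) •
        (overlap μ T (p i - p j))⁻¹ • G (p i - p j) := by
    rw [Finset.sum_comm]
    simp only [Finset.smul_sum, smul_smul, div_eq_mul_inv, mul_comm, mul_left_comm]
  have hosc (h h' : V) (hh : ‖h' - h‖ ≤ 2 * δ) :
      ‖(overlap μ T h')⁻¹ • G h' - (overlap μ T h)⁻¹ • G h‖ₑ ≤
        ENNReal.ofReal (μ.real T / 2)⁻¹ *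
          (b h + ENNReal.ofReal (2 ^ (Module.finrank ℝ V + 1) * (2 * δ / ρ)) * ‖G h‖ₑ) := by
    rw [← ofReal_norm]
    refine (ENNReal.ofReal_le_ofReal
      (norm_inv_overlap_smul_sub_le hT hm hfin hρ hball hR hGR hh)).trans ?_
    rw [ENNReal.ofReal_mul (by positivity), ENNReal.ofReal_add (by positivity) (by positivity),
      ENNReal.ofReal_mul (by positivity), ofReal_norm, ofReal_norm]
    gcongr
    exact hb h h' hh
  have hscale : μ T * ENNReal.ofReal (μ.real T / 2)⁻¹ = 2 := by
    rw [← ofReal_measureReal hfin, ← ENNReal.ofReal_mul hv.le, inv_div, mul_div_cancel₀ _ hv.ne',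
      ENNReal.ofReal_ofNat]
  have hquad := enorm_sum_sum_smul_sub_integral_overlap_le hm hfin hP hPm hp
    (integrable_inv_overlap_smul hT hm hfin hρ hball hR' hGR hG) hosc
  simp only [overlap_smul_inv_overlap_smul hT hm hfin hρ hball hR' hGR] at hquad
  rwa [← hsum, lintegral_const_mul' _ _ ENNReal.ofReal_ne_top, ← mul_assoc, hscale] at hquad

end NormalisedQuadrature

section Voronoi

variable {d n : ℕ} (t : Fin n → E d)

theorem isClosed_region : IsClosed (region t) := isClosed_closure

theorem convex_region : Convex ℝ (region t) := (convex_convexHull ℝ _).closure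

theorem isBounded_region : Bornology.IsBounded (region t) :=
  (isBounded_convexHull.2 (Set.finite_range t).isBounded).closure

theorem volume_region_ne_top : volume (region t) ≠ ∞ := (isBounded_region t).measure_lt_top.ne

theorem mem_region (i : Fin n) : t i ∈ region t :=
  subset_closure (subset_convexHull ℝ _ (Set.mem_range_self i))

theorem isClosed_cell (i : Fin n) : IsClosed (cell t i) := by
  have hcell : cell t i = region t ∩ ⋂ j, {x | ‖x - t i‖ ≤ ‖x - t j‖} := by
    ext x
    simp [cell]
  rw [hcell]
  exact (isClosed_region t).inter
    (isClosed_iInter fun j => isClosed_le (by fun_prop) (by fun_prop))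

theorem meshSize_nonneg : 0 ≤ meshSize t :=
  Real.sSup_nonneg (by rintro _ ⟨i, x, -, rfl⟩; exact norm_nonneg _)

variable {t}

theorem norm_sub_le_meshSize {i : Fin n} {x : E d} (hx : x ∈ cell t i) :
    ‖x - t i‖ ≤ meshSize t := by
  refine le_csSup ⟨Metric.diam (region t), ?_⟩ ⟨i, x, hx, rfl⟩
  rintro _ ⟨j, y, hy, rfl⟩
  rw [← dist_eq_norm]
  exact Metric.dist_le_diam_of_mem (isBounded_region t) hy.1 (mem_region t j)

theorem iUnion_cell : ⋃ i, cell t i = region t := by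
  refine (Set.iUnion_subset fun i x hx => hx.1).antisymm fun x hx => ?_
  obtain ⟨-, i₀, -⟩ := convexHull_nonempty_iff.1 (closure_nonempty_iff.1 ⟨x, hx⟩)
  have : Nonempty (Fin n) := ⟨i₀⟩
  obtain ⟨i, hi⟩ := Finite.exists_min fun i => ‖x - t i‖
  exact Set.mem_iUnion.2 ⟨i, hx, hi⟩

theorem volume_restrict_region_eq_sum (ht : Function.Injective t) :
    volume.restrict (region t) = .sum fun i => volume.restrict (cell t i) := by
  rw [← iUnion_cell]
  refine Measure.restrict_iUnion_ae (fun i j hij => ?_)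
    fun i => (isClosed_cell t i).measurableSet.nullMeasurableSet
  have hbisector : volume (AffineSubspace.perpBisector (t i) (t j) : Set (E d)) = 0 :=
    Measure.addHaar_affineSubspace _ _ (by simpa using ht.ne hij)
  refine measure_mono_null (fun x hx => ?_) hbisector
  rw [SetLike.mem_coe, AffineSubspace.mem_perpBisector_iff_dist_eq, dist_eq_norm, dist_eq_norm]
  exact le_antisymm (hx.1.2 j) (hx.2.2 i)

end Voronoi

section LagWindow

variable {d : ℕ}

theorem norm_character (h θ : E d) : ‖character h θ‖ = 1 := by
  rw [character, mul_comm, Complex.norm_exp_ofReal_mul_I]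

theorem continuous_character (θ : E d) : Continuous fun h => character h θ := by
  unfold character
  fun_prop

theorem character_add (h h' θ : E d) :
    character (h + h') θ = character h θ * character h' θ := by
  simp only [character, inner_add_left, Complex.ofReal_add, mul_add, Complex.exp_add]

theorem norm_character_sub_le (h h' θ : E d) :
    ‖character h' θ - character h θ‖ ≤ ‖θ‖ * ‖h' - h‖ := by
  have hfactor : character h' θ - character h θ =
      character h θ * (character (h' - h) θ - 1) := by
    rw [mul_sub, ← character_add, add_sub_cancel, mul_one]
  rw [hfactor, norm_mul, norm_character, one_mul, mul_comm]
  exact Real.norm_exp_I_mul_ofReal_sub_one_le.trans (norm_inner_le_norm _ _)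

/-- The weight `exp(i h^⊤ θ) K(h / Δ)` given to lag `h` by a kernel with bandwidth `Δ`. -/
noncomputable def lagWindow (K : E d → ℝ) (Δ : ℝ) (θ h : E d) : ℂ :=
  character h θ * (K (Δ⁻¹ • h) : ℂ)

variable {K : E d → ℝ} {L : ℝ≥0} {κ r Δ : ℝ} {θ h h' : E d}

theorem norm_lagWindow : ‖lagWindow K Δ θ h‖ = |K (Δ⁻¹ • h)| := by
  rw [lagWindow, norm_mul, norm_character, one_mul, Complex.norm_real, Real.norm_eq_abs]

theorem continuous_lagWindow (hK : Continuous K) : Continuous (lagWindow K Δ θ) :=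
  (continuous_character θ).mul
    (Complex.continuous_ofReal.comp (hK.comp (continuous_const_smul Δ⁻¹)))

theorem lagWindow_eq_zero (hΔ : 0 < Δ) (hKr : ∀ u, r < ‖u‖ → K u = 0) (hh : r * Δ < ‖h‖) :
    lagWindow K Δ θ h = 0 := by
  have hlarge : r < ‖Δ⁻¹ • h‖ := by
    rwa [norm_smul, norm_inv, Real.norm_of_nonneg hΔ.le, inv_mul_eq_div, lt_div_iff₀ hΔ]
  rw [lagWindow, hKr _ hlarge, Complex.ofReal_zero, mul_zero]

theorem norm_lagWindow_sub_le (hL : LipschitzWith L K) (hκ : ∀ u, |K u| ≤ κ) (hΔ : 0 < Δ) :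
    ‖lagWindow K Δ θ h' - lagWindow K Δ θ h‖ ≤ (L / Δ + κ * ‖θ‖) * ‖h' - h‖ := by
  have hK : |K (Δ⁻¹ • h') - K (Δ⁻¹ • h)| ≤ L / Δ * ‖h' - h‖ := by
    have hdist := hL.dist_le_mul (Δ⁻¹ • h') (Δ⁻¹ • h)
    rwa [Real.dist_eq, dist_eq_norm, ← smul_sub, norm_smul, norm_inv, Real.norm_of_nonneg hΔ.le,
      ← mul_assoc, ← div_eq_mul_inv] at hdist
  have hsplit : lagWindow K Δ θ h' - lagWindow K Δ θ h =
      character h' θ * ((K (Δ⁻¹ • h') - K (Δ⁻¹ • h) : ℝ) : ℂ) +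
        (character h' θ - character h θ) * (K (Δ⁻¹ • h) : ℂ) := by
    simp only [lagWindow, Complex.ofReal_sub]
    ring
  rw [hsplit, add_mul]
  refine norm_add_le_of_le ?_ ?_ <;>
    rw [norm_mul, Complex.norm_real, Real.norm_eq_abs]
  · rwa [norm_character, one_mul]
  · rw [mul_comm, mul_assoc]
    exact mul_le_mul (hκ _) (norm_character_sub_le h h' θ) (norm_nonneg _)
      ((abs_nonneg _).trans (hκ 0))

variable {F : Type*} [NormedAddCommGroup F] [NormedSpace ℂ F]

theorem enorm_lagWindow_smul_le (hκ : ∀ u, |K u| ≤ κ) (x : F) :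
    ‖lagWindow K Δ θ h • x‖ₑ ≤ ENNReal.ofReal κ * ‖x‖ₑ := by
  rw [enorm_smul, ← ofReal_norm, norm_lagWindow]
  gcongr
  exact hκ _

theorem enorm_lagWindow_smul_sub_le (hL : LipschitzWith L K) (hκ : ∀ u, |K u| ≤ κ) (hΔ : 0 < Δ)
    {η : ℝ} (hh : ‖h' - h‖ ≤ η) (x y : F) :
    ‖lagWindow K Δ θ h' • y - lagWindow K Δ θ h • x‖ₑ ≤
      ENNReal.ofReal κ * ‖y - x‖ₑ + ENNReal.ofReal ((L / Δ + κ * ‖θ‖) * η) * ‖x‖ₑ := by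
  have hκ0 : 0 ≤ κ := (abs_nonneg _).trans (hκ 0)
  have hsplit : lagWindow K Δ θ h' • y - lagWindow K Δ θ h • x =
      lagWindow K Δ θ h' • (y - x) + (lagWindow K Δ θ h' - lagWindow K Δ θ h) • x := by
    rw [smul_sub, sub_smul, sub_add_sub_cancel]
  rw [hsplit]
  refine (enorm_add_le _ _).trans (add_le_add (enorm_lagWindow_smul_le hκ _) ?_)
  rw [enorm_smul, ← ofReal_norm (_ - _)]
  gcongr
  exact (norm_lagWindow_sub_le hL hκ hΔ).trans (by gcongr)

theorem integrable_lagWindow_smul {C : E d → F} (hC : Integrable C) (hK : Continuous K)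
    (hκ : ∀ u, |K u| ≤ κ) : Integrable fun h => lagWindow K Δ θ h • C h :=
  hC.bdd_smul κ (continuous_lagWindow hK).aestronglyMeasurable
    (ae_of_all _ fun _ => norm_lagWindow.trans_le (hκ _))

end LagWindow

section TaperedDensity

variable {H : Type*} [NormedAddCommGroup H] [InnerProductSpace ℂ H]
variable {d : ℕ} {C : E d → H →L[ℂ] H} {K : E d → ℝ} {κ Δ : ℝ}

/-- The spectral density with `C(h)` damped to `C(h) K(h / Δ)`, which is what the estimator targets
in expectation. -/
noncomputable def taperedDensity (K : E d → ℝ) (C : E d → H →L[ℂ] H) (Δ : ℝ) (θ : E d) :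
    H →L[ℂ] H :=
  (((2 * Real.pi) ^ d)⁻¹ : ℝ) • ∫ h, lagWindow K Δ θ h • C h

theorem enorm_inv_two_pi_pow_le_one (d : ℕ) : ‖(((2 * Real.pi) ^ d)⁻¹ : ℝ)‖ₑ ≤ 1 := by
  rw [Real.enorm_of_nonneg (by positivity), ENNReal.ofReal_le_one]
  exact inv_le_one_of_one_le₀ (one_le_pow₀ (by linarith [Real.pi_gt_three]))

theorem mem_smul_posSet_iff (hΔ : 0 < Δ) {h : E d} : h ∈ Δ • posSet K ↔ 0 < K (Δ⁻¹ • h) :=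
  Set.mem_smul_set_iff_inv_smul_mem₀ hΔ.ne' _ _

theorem measurableSet_smul_posSet (hK : Continuous K) (hΔ : 0 < Δ) :
    MeasurableSet (Δ • posSet K) :=
  ((isOpen_lt continuous_const hK).smul₀ hΔ.ne').measurableSet

theorem integral_lagWindow_sub_integral_character (hC : Integrable C) (hK : Continuous K)
    (hK0 : ∀ u, 0 ≤ K u) (hκ : ∀ u, |K u| ≤ κ) (hΔ : 0 < Δ) (θ : E d) :
    (∫ h, lagWindow K Δ θ h • C h) - ∫ h, character h θ • C h =
      -((∫ h in Δ • posSet K, (character h θ * ((1 - K (Δ⁻¹ • h) : ℝ) : ℂ)) • C h) +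
        ∫ h in (Δ • posSet K)ᶜ, character h θ • C h) := by
  have hm := measurableSet_smul_posSet hK hΔ
  have hchar : Integrable fun h => character h θ • C h :=
    hC.bdd_smul 1 (continuous_character θ).aestronglyMeasurable
      (ae_of_all _ fun h => (norm_character h θ).le)
  have hlag : Integrable fun h => lagWindow K Δ θ h • C h := integrable_lagWindow_smul hC hK hκ
  have hon (h : E d) : (character h θ * ((1 - K (Δ⁻¹ • h) : ℝ) : ℂ)) • C h =
      character h θ • C h - lagWindow K Δ θ h • C h := by
    rw [lagWindow, ← sub_smul, Complex.ofReal_sub, Complex.ofReal_one, mul_one_sub]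
  have hoff : ∫ h in (Δ • posSet K)ᶜ, lagWindow K Δ θ h • C h = 0 := by
    refine setIntegral_eq_zero_of_forall_eq_zero fun h hh => ?_
    have hzero : K (Δ⁻¹ • h) = 0 :=
      (not_lt.1 fun hpos => hh ((mem_smul_posSet_iff hΔ).2 hpos)).antisymm (hK0 _)
    rw [lagWindow, hzero, Complex.ofReal_zero, mul_zero, zero_smul]
  simp only [hon]
  rw [integral_sub hchar.integrableOn hlag.integrableOn, ← integral_add_compl hm hchar,
    ← integral_add_compl hm hlag, hoff]
  abel

variable [CompleteSpace H] {ι : Type*} (e : HilbertBasis ι ℂ H)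

theorem hsNorm_inv_two_pi_pow_smul_le (A : H →L[ℂ] H) :
    hsNorm e ((((2 * Real.pi) ^ d)⁻¹ : ℝ) • A) ≤ hsNorm e A :=
  (hsNorm_smul_le e _ A).trans (mul_le_of_le_one_left zero_le (enorm_inv_two_pi_pow_le_one d))

theorem hsNorm_taperedDensity_sub_spectralDensity_le (hC : Integrable C) (hK : Continuous K)
    (hK0 : ∀ u, 0 ≤ K u) (hκ : ∀ u, |K u| ≤ κ) (hΔ : 0 < Δ) (θ : E d) :
    hsNorm e (taperedDensity K C Δ θ - spectralDensity C θ) ≤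
      biasOne e C K Δ θ + biasTwo e C K Δ θ := by
  rw [taperedDensity, spectralDensity, ← smul_sub,
    integral_lagWindow_sub_integral_character hC hK hK0 hκ hΔ]
  refine (hsNorm_inv_two_pi_pow_smul_le e _).trans ?_
  rw [hsNorm_neg]
  exact hsNorm_add_le e _ _

end TaperedDensity

section Expectation

variable {H : Type*} [NormedAddCommGroup H] [InnerProductSpace ℂ H]
variable {Ω : Type*} [MeasurableSpace Ω] {μ : Measure Ω}

theorem continuous_rankOne :
    Continuous fun z : H × H => InnerProductSpace.rankOne ℂ z.1 z.2 := by
  have h : Continuous fun z : H × H =>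
      ContinuousLinearMap.smulRightL ℂ H H (innerSL ℂ z.2) z.1 := by fun_prop
  exact h

theorem integrable_rankOne {f g : Ω → H} (hf : MemLp f 2 μ) (hg : MemLp g 2 μ) :
    Integrable (fun ω => InnerProductSpace.rankOne ℂ (f ω) (g ω)) μ := by
  have hmeas : AEStronglyMeasurable (fun ω => InnerProductSpace.rankOne ℂ (f ω) (g ω)) μ := by
    have h := (continuous_rankOne (H := H)).comp_aestronglyMeasurable (hf.1.prodMk hg.1)
    exact h
  have hprod : Integrable (fun ω => ‖f ω‖ * ‖g ω‖) μ := hf.norm.integrable_mul hg.norm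
  exact hprod.mono' hmeas (ae_of_all _ fun ω => (InnerProductSpace.norm_rankOne _ _).le)

variable [CompleteSpace H] {d : ℕ} {X : E d → Ω → H}

theorem vol_region_inter_image_sub_eq_overlap {n : ℕ} (t : Fin n → E d) (h : E d) :
    vol (region t ∩ (fun x => x - h) '' region t) = overlap volume (region t) h := by
  simp only [overlap, vol, measureReal_def, ← Set.image_vadd, vadd_eq_add, neg_add_eq_sub]

theorem integral_estimator (hX : ∀ s, MemLp (X s) 2 μ)
    (hcov : ∀ s s', covOp X μ s s' = statCov X μ (s - s')) (K : E d → ℝ) {n : ℕ}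
    (t : Fin n → E d) (Δ : ℝ) (θ : E d) :
    ∫ ω, estimator X K t Δ θ ω ∂μ = (((2 * Real.pi) ^ d)⁻¹ : ℝ) • ∑ i, ∑ j,
      (volume.real (cell t i) * volume.real (cell t j) /
        overlap volume (region t) (t i - t j)) •
          lagWindow K Δ θ (t i - t j) • statCov X μ (t i - t j) := by
  have hint (c : ℂ) (i j : Fin n) : Integrable
      (fun ω => c • InnerProductSpace.rankOne ℂ (X (t i) ω) (X (t j) ω)) μ :=
    (integrable_rankOne (hX (t i)) (hX (t j))).smul c
  simp only [estimator, vol_region_inter_image_sub_eq_overlap]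
  rw [integral_smul, integral_finsetSum _ fun i _ => integrable_finsetSum _ fun j _ => hint _ i j]
  congr 1
  refine Finset.sum_congr rfl fun i _ => ?_
  rw [integral_finsetSum _ fun j _ => hint _ i j]
  refine Finset.sum_congr rfl fun j _ => ?_
  rw [integral_smul, ← hcov, covOp, ← Complex.coe_smul (_ / _), smul_smul, lagWindow]
  congr 1
  simp only [vol, measureReal_def]
  push_cast
  ring

end Expectation

section Discretization

variable {d n : ℕ} {t : Fin n → E d} {K : E d → ℝ} {L : ℝ≥0} {κ r ρ Δ : ℝ} {x₀ : E d}

theorem enorm_sum_sum_lagWindow_sub_integral_le {F : Type*} [NormedAddCommGroup F]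
    [NormedSpace ℂ F] [CompleteSpace F] {G : E d → F} (hG : Integrable G) {b : E d → ℝ≥0∞}
    (hb : ∀ h h', ‖h' - h‖ ≤ 2 * meshSize t → ‖G h' - G h‖ₑ ≤ b h)
    (hL : LipschitzWith L K) (hκ : ∀ u, |K u| ≤ κ) (hKr : ∀ u, r < ‖u‖ → K u = 0) (hΔ : 0 < Δ)
    (ht : Function.Injective t) (hρ : 0 < ρ) (hball : Metric.closedBall x₀ ρ ⊆ region t)
    (hρΔ : 2 ^ (d + 1) * (r * Δ + 2 * meshSize t) ≤ ρ) (θ : E d) :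
    ‖∑ i, ∑ j, (volume.real (cell t i) * volume.real (cell t j) /
        overlap volume (region t) (t i - t j)) • lagWindow K Δ θ (t i - t j) • G (t i - t j) -
          ∫ h, lagWindow K Δ θ h • G h‖ₑ ≤
      2 * (ENNReal.ofReal κ * (∫⁻ h, b h) +
        ENNReal.ofReal ((L / Δ + κ * ‖θ‖ + κ * (2 ^ (d + 1) / ρ)) * (2 * meshSize t)) *
          ∫⁻ h, ‖G h‖ₑ) := by
  have hδ := meshSize_nonneg t
  have hκ0 : 0 ≤ κ := (abs_nonneg _).trans (hκ 0)
  have hosc (h h' : E d) (hh : ‖h' - h‖ ≤ 2 * meshSize t) :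
      ‖lagWindow K Δ θ h' • G h' - lagWindow K Δ θ h • G h‖ₑ ≤
        ENNReal.ofReal κ * b h +
          ENNReal.ofReal ((L / Δ + κ * ‖θ‖) * (2 * meshSize t)) * ‖G h‖ₑ := by
    refine (enorm_lagWindow_smul_sub_le hL hκ hΔ hh _ _).trans ?_
    gcongr
    exact hb h h' hh
  have hquad := enorm_sum_sum_div_overlap_smul_sub_integral_le (convex_region t)
    (isClosed_region t).measurableSet (volume_region_ne_top t) hρ hball hδ
    (volume_restrict_region_eq_sum ht) (fun i => (isClosed_cell t i).measurableSet)
    (fun i x => norm_sub_le_meshSize) (by rwa [finrank_euclideanSpace_fin])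
    (fun h hh => by rw [lagWindow_eq_zero hΔ hKr hh, zero_smul])
    (integrable_lagWindow_smul hG hL.continuous hκ)
    hosc
  refine hquad.trans ?_
  rw [finrank_euclideanSpace_fin, ← lintegral_const_mul' _ _ ENNReal.ofReal_ne_top,
    ← lintegral_const_mul' _ _ ENNReal.ofReal_ne_top,
    ← lintegral_add_right' _ (hG.1.enorm.const_mul _)]
  refine mul_le_mul_right (lintegral_mono fun h => ?_) 2
  rw [add_assoc]
  refine add_le_add_right ?_ _
  calc _ ≤ ENNReal.ofReal ((L / Δ + κ * ‖θ‖) * (2 * meshSize t)) * ‖G h‖ₑ +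
        ENNReal.ofReal (2 ^ (d + 1) * (2 * meshSize t / ρ)) *
          (ENNReal.ofReal κ * ‖G h‖ₑ) := by
        gcongr
        exact enorm_lagWindow_smul_le hκ _
    _ = _ := by
        rw [← mul_assoc (ENNReal.ofReal _) (ENNReal.ofReal κ),
          ← ENNReal.ofReal_mul (by positivity), ← add_mul,
          ← ENNReal.ofReal_add (by positivity) (by positivity)]
        ring_nf

variable {H : Type*} [NormedAddCommGroup H] [InnerProductSpace ℂ H] [CompleteSpace H]
variable {ι : Type*} {e : HilbertBasis ι ℂ H} {C : E d → H →L[ℂ] H}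

theorem hsNorm_sum_sum_lagWindow_sub_integral_le (hC : Integrable C) (hL : LipschitzWith L K)
    (hκ : ∀ u, |K u| ≤ κ) (hKr : ∀ u, r < ‖u‖ → K u = 0) (hΔ : 0 < Δ)
    (ht : Function.Injective t) (hρ : 0 < ρ) (hball : Metric.closedBall x₀ ρ ⊆ region t)
    (hρΔ : 2 ^ (d + 1) * (r * Δ + 2 * meshSize t) ≤ ρ) (θ : E d) :
    hsNorm e (∑ i, ∑ j, (volume.real (cell t i) * volume.real (cell t j) /
        overlap volume (region t) (t i - t j)) • lagWindow K Δ θ (t i - t j) • C (t i - t j) -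
          ∫ h, lagWindow K Δ θ h • C h) ≤
      2 * (ENNReal.ofReal κ * (∫⁻ h, oscTr e C (2 * meshSize t) h) +
        ENNReal.ofReal ((L / Δ + κ * ‖θ‖ + κ * (2 ^ (d + 1) / ρ)) * (2 * meshSize t)) *
          ∫⁻ h, traceNorm e (C h)) := by
  refine hsNorm_le_of_forall_enorm_basisValues_le e fun S => ?_
  have hvalues (A : H →L[ℂ] H) : ‖basisValues e S A‖ₑ ≤ traceNorm e A :=
    (enorm_basisValues_le e S A).trans (hsNorm_le_traceNorm e A)
  have hosc (h h' : E d) (hh : ‖h' - h‖ ≤ 2 * meshSize t) :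
      ‖basisValues e S (C h') - basisValues e S (C h)‖ₑ ≤ oscTr e C (2 * meshSize t) h := by
    rw [← map_sub]
    exact (hvalues _).trans (le_iSup₂_of_le h' (by rwa [norm_sub_rev]) le_rfl)
  have hquad := enorm_sum_sum_lagWindow_sub_integral_le ((basisValues e S).integrable_comp hC)
    hosc hL hκ hKr hΔ ht hρ hball hρΔ θ
  simp only [← map_smul] at hquad
  rw [(basisValues e S).integral_comp_comm (integrable_lagWindow_smul hC hL.continuous hκ)]
    at hquad
  simp only [← Complex.coe_smul (_ / _), map_sub, map_sum, map_smul] at hquad ⊢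
  refine hquad.trans ?_
  gcongr
  exact hvalues _

variable {Ω : Type*} [MeasurableSpace Ω] {μ : Measure Ω} {X : E d → Ω → H}

theorem hsNorm_integral_estimator_sub_taperedDensity_le (hX : ∀ s, MemLp (X s) 2 μ)
    (hcov : ∀ s s', covOp X μ s s' = statCov X μ (s - s')) (hC : Integrable (statCov X μ))
    (hL : LipschitzWith L K) (hκ : ∀ u, |K u| ≤ κ) (hKr : ∀ u, r < ‖u‖ → K u = 0) (hΔ : 0 < Δ)
    (ht : Function.Injective t) (hρ : 0 < ρ) (hball : Metric.closedBall x₀ ρ ⊆ region t)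
    (hρΔ : 2 ^ (d + 1) * (r * Δ + 2 * meshSize t) ≤ ρ) (θ : E d) :
    hsNorm e ((∫ ω, estimator X K t Δ θ ω ∂μ) - taperedDensity K (statCov X μ) Δ θ) ≤
      2 * (ENNReal.ofReal κ * (∫⁻ h, oscTr e (statCov X μ) (2 * meshSize t) h) +
        ENNReal.ofReal ((L / Δ + κ * ‖θ‖ + κ * (2 ^ (d + 1) / ρ)) * (2 * meshSize t)) *
          ∫⁻ h, traceNorm e (statCov X μ h)) := by
  rw [integral_estimator hX hcov, taperedDensity, ← smul_sub]
  exact (hsNorm_inv_two_pi_pow_smul_le e _).trans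
    (hsNorm_sum_sum_lagWindow_sub_integral_le hC hL hκ hKr hΔ ht hρ hball hρΔ θ)

end Discretization

section Conditions

variable {H : Type*} [NormedAddCommGroup H] [InnerProductSpace ℂ H] [CompleteSpace H]
variable {ι : Type*} (e : HilbertBasis ι ℂ H)

theorem integrable_of_lintegral_traceNorm_lt_top {α : Type*} [MeasurableSpace α] {μ : Measure α}
    {A : α → H →L[ℂ] H} (hm : AEStronglyMeasurable A μ) (h : ∫⁻ x, traceNorm e (A x) ∂μ < ∞) :
    Integrable A μ :=
  ⟨hm, (lintegral_mono fun x =>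
    (enorm_le_hsNorm e (A x)).trans (hsNorm_le_traceNorm e (A x))).trans_lt h⟩

variable {e} {d : ℕ}

theorem oscTr_zero (C : E d → H →L[ℂ] H) (x : E d) : oscTr e C 0 x = 0 := by
  refine le_antisymm (iSup₂_le fun y hy => ?_) zero_le
  rw [sub_eq_zero.1 (norm_le_zero_iff.1 hy)]
  simp [traceNorm]

theorem CovarianceCondition.exists_lintegral_oscTr_le {C : E d → H →L[ℂ] H} {γ : ℝ}
    (hC : CovarianceCondition e C γ) : ∃ M : ℝ, 0 ≤ M ∧
      ∀ δ, 0 ≤ δ → δ < 1 → ∫⁻ x, oscTr e C δ x ≤ ENNReal.ofReal (M * δ ^ γ) := by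
  obtain ⟨M, hM⟩ := hC.holder
  refine ⟨|M|, abs_nonneg M, fun δ hδ0 hδ1 => ?_⟩
  rcases hδ0.eq_or_lt with rfl | hδ0
  · simp only [oscTr_zero, lintegral_zero, zero_le]
  · refine (hM δ hδ0 hδ1).2.trans ?_
    gcongr
    exact le_abs_self M

variable {K : E d → ℝ}

theorem exists_forall_norm_gt_eq_zero (hK0 : ∀ u, 0 ≤ K u)
    (hbdd : Bornology.IsBounded (posSet K)) : ∃ r > 0, ∀ u, r < ‖u‖ → K u = 0 := by
  obtain ⟨r, hr, hle⟩ := hbdd.exists_pos_norm_le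
  exact ⟨r, hr, fun u hu => (not_lt.1 fun hpos => hu.not_ge (hle u hpos)).antisymm (hK0 u)⟩

theorem exists_forall_abs_le (hK : Continuous K) {r : ℝ} (hKr : ∀ u, r < ‖u‖ → K u = 0) :
    ∃ κ, ∀ u, |K u| ≤ κ := by
  have hsupp : HasCompactSupport K := .of_support_subset_isCompact
    (isCompact_closedBall 0 r) fun u hu => mem_closedBall_zero_iff.2 <|
      not_lt.1 fun h => hu (hKr u h)
  exact hsupp.exists_bound_of_continuous hK

end Conditions

section Rate

theorem two_mul_add_le_ofReal_mul_ofReal_rpow {γ δ κ M A N : ℝ} (hγ : γ ≤ 1) (hδ0 : 0 ≤ δ)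
    (hδ1 : δ ≤ 1) (hκ : 0 ≤ κ) (hM : 0 ≤ M) (hA : 0 ≤ A) (hN : 0 ≤ N) :
    2 * (ENNReal.ofReal κ * ENNReal.ofReal (M * (2 * δ) ^ γ) +
      ENNReal.ofReal (A * (2 * δ)) * ENNReal.ofReal N) ≤
        ENNReal.ofReal (2 * (κ * (M * 2 ^ γ) + A * 2 * N)) * ENNReal.ofReal (δ ^ γ) := by
  have hδγ : δ ≤ δ ^ γ := Real.self_le_rpow_of_le_one hδ0 hδ1 hγ
  rw [← ENNReal.ofReal_ofNat, ← ENNReal.ofReal_mul hκ, ← ENNReal.ofReal_mul (by positivity),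
    ← ENNReal.ofReal_add (by positivity) (by positivity), ← ENNReal.ofReal_mul zero_le_two,
    ← ENNReal.ofReal_mul (by positivity)]
  refine ENNReal.ofReal_le_ofReal ?_
  calc 2 * (κ * (M * (2 * δ) ^ γ) + A * (2 * δ) * N)
      = 2 * (κ * (M * 2 ^ γ) * δ ^ γ + A * 2 * N * δ) := by
        rw [Real.mul_rpow zero_le_two hδ0]
        ring
    _ ≤ 2 * (κ * (M * 2 ^ γ) * δ ^ γ + A * 2 * N * δ ^ γ) := by gcongr
    _ = 2 * (κ * (M * 2 ^ γ) + A * 2 * N) * δ ^ γ := by ring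

variable {H : Type*} [NormedAddCommGroup H] [InnerProductSpace ℂ H] [CompleteSpace H]
variable {ι : Type*} {e : HilbertBasis ι ℂ H} {Ω : Type*} [MeasurableSpace Ω] {μ : Measure Ω}
variable {d : ℕ} {X : E d → Ω → H} {γ : ℝ} {K : E d → ℝ} {L : ℝ≥0}
variable {t : (n : ℕ) → Fin n → E d} {x : ℕ → E d} {ρ Δ : ℕ → ℝ} {b : ℝ} {Θ : Set (E d)}

theorem exists_eventually_hsNorm_integral_estimator_sub_taperedDensity_le
    (hX : ∀ s, MemLp (X s) 2 μ) (hcov : ∀ s s', covOp X μ s s' = statCov X μ (s - s'))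
    (hC : CovarianceCondition e (statCov X μ) γ) (hK0 : ∀ u, 0 ≤ K u)
    (hbdd : Bornology.IsBounded (posSet K)) (hL : LipschitzWith L K)
    (ht : ∀ n, Function.Injective (t n)) (hmesh : Tendsto (fun n => meshSize (t n)) atTop (𝓝 0))
    (hball : ∀ᶠ n in atTop, Metric.closedBall (x n) (ρ n) ⊆ region (t n))
    (hρΔ : Tendsto (fun n => ρ n / Δ n) atTop atTop) (hb : 0 < b) (hΔ : ∀ᶠ n in atTop, b ≤ Δ n)
    (hΘ : Bornology.IsBounded Θ) :
    ∃ D : ℝ, ∀ᶠ n in atTop, ∀ θ ∈ Θ,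
      hsNorm e ((∫ ω, estimator X K (t n) (Δ n) θ ω ∂μ) -
        taperedDensity K (statCov X μ) (Δ n) θ) ≤
          ENNReal.ofReal D * ENNReal.ofReal (meshSize (t n) ^ γ) := by
  obtain ⟨M, hM0, hM⟩ := hC.exists_lintegral_oscTr_le
  obtain ⟨r, hr, hKr⟩ := exists_forall_norm_gt_eq_zero hK0 hbdd
  obtain ⟨κ, hκ⟩ := exists_forall_abs_le hL.continuous hKr
  obtain ⟨B, hB0, hB⟩ := hΘ.exists_pos_norm_le
  have hκ0 : 0 ≤ κ := (abs_nonneg _).trans (hκ 0)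
  have hCint := integrable_of_lintegral_traceNorm_lt_top e hC.aestronglyMeasurable hC.integrable
  set N := (∫⁻ h, traceNorm e (statCov X μ h)).toReal
  have hN : ∫⁻ h, traceNorm e (statCov X μ h) = ENNReal.ofReal N :=
    (ENNReal.ofReal_toReal hC.integrable.ne).symm
  refine ⟨2 * (κ * (M * 2 ^ γ) + (L / b + κ * B + κ) * 2 * N), ?_⟩
  filter_upwards [hmesh.eventually_lt_const one_half_pos, hball, hΔ,
    hρΔ.eventually_ge_atTop (2 ^ (d + 1) * (r + 1 / b))] with n hδ hballn hbΔ hratio θ hθ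
  have hδ0 := meshSize_nonneg (t n)
  have hΔ0 : 0 < Δ n := hb.trans_le hbΔ
  have hΔb : 1 ≤ Δ n / b := (one_le_div₀ hb).2 hbΔ
  have hρ : 2 ^ (d + 1) * (r * Δ n + Δ n / b) ≤ ρ n := by
    rw [le_div_iff₀ hΔ0] at hratio
    exact le_of_eq_of_le (by ring) hratio
  have hρ0 : 0 < ρ n := lt_of_lt_of_le (by positivity) hρ
  have hpow : 2 ^ (d + 1) / ρ n ≤ 1 := by
    refine (div_le_one₀ hρ0).2 ((le_mul_of_one_le_right (by positivity) ?_).trans hρ)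
    exact hΔb.trans (le_add_of_nonneg_left (by positivity))
  have hδρ : 2 ^ (d + 1) * (r * Δ n + 2 * meshSize (t n)) ≤ ρ n := by
    refine le_trans ?_ hρ
    gcongr
    linarith
  refine (hsNorm_integral_estimator_sub_taperedDensity_le hX hcov hCint hL hκ hKr hΔ0 (ht n) hρ0
    hballn hδρ θ).trans (le_trans ?_ (two_mul_add_le_ofReal_mul_ofReal_rpow hC.gamma_le_one hδ0
      (by linarith) hκ0 hM0 (by positivity) ENNReal.toReal_nonneg))
  rw [hN]
  gcongr
  · exact hM _ (by positivity) (by linarith)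
  · exact hB θ hθ
  · exact mul_le_of_le_one_right hκ0 hpow

end Rate

section InscribedBalls

variable {d : ℕ} {t : (n : ℕ) → Fin n → E d} {Δ : ℕ → ℝ}

theorem SamplingCondition.dim_ne_zero (ht : SamplingCondition t) : d ≠ 0 := by
  rintro rfl
  obtain ⟨n, hn⟩ := (ht.volume_region.eventually_gt_atTop (vol (Set.univ : Set (E 0)))).exists
  exact hn.not_ge (ENNReal.toReal_mono (Set.toFinite _).isBounded.measure_lt_top.ne
    (measure_mono (Set.subset_univ _)))

theorem SamplingCondition.exists_closedBall_subset (ht : SamplingCondition t) :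
    ∃ r > 0, ∃ x : ℕ → E d, ∀ᶠ n in atTop,
      Metric.closedBall (x n) (r * vol (region (t n)) ^ (1 / (d : ℝ))) ⊆ region (t n) := by
  obtain ⟨T, -, -, ⟨y, hy⟩, hlim⟩ := ht.shape
  obtain ⟨s, hs, hball⟩ := Metric.nhds_basis_closedBall.mem_iff.1 (mem_interior_iff_mem_nhds.1 hy)
  refine ⟨s / 2, half_pos hs, fun n => vol (region (t n)) ^ (1 / (d : ℝ)) • y, ?_⟩
  filter_upwards [hlim.eventually_lt_const (ENNReal.ofReal_pos.2 (half_pos hs)),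
    ht.volume_region.eventually_gt_atTop 0] with n hn hv
  have hscale : 0 < vol (region (t n)) ^ (1 / (d : ℝ)) := Real.rpow_pos_of_pos hv _
  have hsub := closedBall_subset_of_hausdorffEDist_lt ((convex_region (t n)).smul _)
    ((isClosed_region (t n)).smul₀ _) (half_pos hs)
    (hball.trans' (Metric.closedBall_subset_closedBall (by linarith))) hn
  rwa [Set.subset_smul_set_iff₀ (inv_ne_zero hscale.ne'), inv_inv,
    smul_closedBall _ _ (half_pos hs).le, Real.norm_of_nonneg hscale.le, mul_comm] at hsub

theorem SamplingCondition.exists_inscribed_balls (ht : SamplingCondition t)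
    (hΔ : Tendsto Δ atTop atTop)
    (hsmall : Tendsto (fun n => Δ n ^ d / vol (region (t n))) atTop (𝓝 0)) :
    ∃ (x : ℕ → E d) (ρ : ℕ → ℝ), (∀ᶠ n in atTop, Metric.closedBall (x n) (ρ n) ⊆ region (t n)) ∧
      Tendsto (fun n => ρ n / Δ n) atTop atTop := by
  obtain ⟨r, hr, x, hball⟩ := ht.exists_closedBall_subset
  refine ⟨x, _, hball, ?_⟩
  have hd := ht.dim_ne_zero
  have hpos : ∀ᶠ n in atTop, 0 < Δ n ∧ 0 < vol (region (t n)) :=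
    (hΔ.eventually_gt_atTop 0).and (ht.volume_region.eventually_gt_atTop 0)
  have hinv : Tendsto (fun n => (Δ n ^ d / vol (region (t n)))⁻¹) atTop atTop :=
    tendsto_inv_nhdsGT_zero.comp <| tendsto_nhdsWithin_iff.2
      ⟨hsmall, hpos.mono fun n h => div_pos (pow_pos h.1 d) h.2⟩
  have hroot : Tendsto (fun n => r * (Δ n ^ d / vol (region (t n)))⁻¹ ^ (1 / (d : ℝ)))
      atTop atTop :=
    ((tendsto_rpow_atTop (by positivity)).comp hinv).const_mul_atTop hr
  refine hroot.congr' (hpos.mono fun n ⟨hΔn, hv⟩ => ?_)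
  rw [inv_div, Real.div_rpow hv.le (by positivity), one_div, Real.pow_rpow_inv_natCast hΔn.le hd,
    ← mul_div_assoc]

end InscribedBalls

end SpectralBias

open SpectralBias in
theorem mainTheorem5_general
    {H : Type*} [NormedAddCommGroup H] [InnerProductSpace ℂ H] [CompleteSpace H]
    {ι : Type*} (e : HilbertBasis ι ℂ H) {Ω : Type*} [MeasurableSpace Ω] (μ : Measure Ω)
    {d : ℕ} (X : E d → Ω → H) (hX : ∀ s, MemLp (X s) 2 μ)
    (hcov : ∀ s s', covOp X μ s s' = statCov X μ (s - s'))
    (γ : ℝ) (hC : CovarianceCondition e (statCov X μ) γ)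
    (K : E d → ℝ) (hK0 : ∀ u, 0 ≤ K u) (hbdd : Bornology.IsBounded (posSet K))
    (hLip : ∃ L : ℝ≥0, LipschitzWith L K)
    (t : (n : ℕ) → Fin n → E d) (ht : ∀ n, Function.Injective (t n))
    (hmesh : Tendsto (fun n => meshSize (t n)) atTop (𝓝 0))
    (Δ : ℕ → ℝ) (b : ℝ) (hb : 0 < b) (hΔ : ∀ᶠ n in atTop, b ≤ Δ n) (x : ℕ → E d) (ρ : ℕ → ℝ)
    (hball : ∀ᶠ n in atTop, Metric.closedBall (x n) (ρ n) ⊆ region (t n))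
    (hρΔ : Tendsto (fun n => ρ n / Δ n) atTop atTop)
    (Θ : Set (E d)) (hΘ : Bornology.IsBounded Θ) :
    ∃ M : ℝ, ∀ᶠ n in atTop, ∀ θ ∈ Θ,
      hsNorm e ((∫ ω, estimator X K (t n) (Δ n) θ ω ∂μ) - spectralDensity (statCov X μ) θ) ≤
        ENNReal.ofReal M * (ENNReal.ofReal (meshSize (t n) ^ γ) +
          biasOne e (statCov X μ) K (Δ n) θ + biasTwo e (statCov X μ) K (Δ n) θ) := by
  obtain ⟨L, hL⟩ := hLip
  obtain ⟨r, -, hKr⟩ := exists_forall_norm_gt_eq_zero hK0 hbdd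
  obtain ⟨κ, hκ⟩ := exists_forall_abs_le hL.continuous hKr
  obtain ⟨D, hD⟩ := exists_eventually_hsNorm_integral_estimator_sub_taperedDensity_le hX hcov hC
    hK0 hbdd hL ht hmesh hball hρΔ hb hΔ hΘ
  refine ⟨max D 1, ?_⟩
  filter_upwards [hD, hΔ] with n hdiscretization hΔn θ hθ
  have htapering := hsNorm_taperedDensity_sub_spectralDensity_le e
    (integrable_of_lintegral_traceNorm_lt_top e hC.aestronglyMeasurable hC.integrable)
    hL.continuous hK0 hκ (hb.trans_le hΔn) θ
  rw [← sub_add_sub_cancel _ (taperedDensity K (statCov X μ) (Δ n) θ), add_assoc, mul_add]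
  refine (hsNorm_add_le e _ _).trans (add_le_add ((hdiscretization θ hθ).trans ?_)
    (htapering.trans ?_))
  · gcongr
    exact le_max_left D 1
  · exact le_mul_of_one_le_left zero_le (ENNReal.one_le_ofReal.2 (le_max_right D 1))

open SpectralBias in
theorem mainTheorem5
    {H : Type*} [NormedAddCommGroup H] [InnerProductSpace ℂ H] [CompleteSpace H]
    [TopologicalSpace.SeparableSpace H]
    {ι : Type*} (e : HilbertBasis ι ℂ H)
    {Ω : Type*} [MeasurableSpace Ω] (μ : Measure Ω) [IsProbabilityMeasure μ]
    {d : ℕ} (X : E d → Ω → H)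
    (hX : IsSecondOrderStationary e X μ) (hreal : IsRealProcess e X μ)
    (γ : ℝ) (hC : CovarianceCondition e (statCov X μ) γ)
    (K : E d → ℝ) (hK : KernelCondition K) (hLip : ∃ L : ℝ≥0, LipschitzWith L K)
    (t : (n : ℕ) → Fin n → E d) (ht : SamplingCondition t)
    (Δ : ℕ → ℝ) (hΔ : Tendsto Δ atTop atTop)
    (hsub : ∀ᶠ n in atTop, Δ n • posSet K ⊆ region (t n) - region (t n))
    (hsmall : Tendsto (fun n => Δ n ^ d / vol (region (t n))) atTop (𝓝 0))
    (Θ : Set (E d)) (hΘ : Bornology.IsBounded Θ) :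
    ∃ M : ℝ, ∀ᶠ n in atTop, ∀ θ ∈ Θ,
      hsNorm e ((∫ ω, estimator X K (t n) (Δ n) θ ω ∂μ) - spectralDensity (statCov X μ) θ) ≤
        ENNReal.ofReal M * (ENNReal.ofReal (meshSize (t n) ^ γ) +
          biasOne e (statCov X μ) K (Δ n) θ + biasTwo e (statCov X μ) K (Δ n) θ) := by
  obtain ⟨x, ρ, hball, hρΔ⟩ := ht.exists_inscribed_balls hΔ hsmall
  exact mainTheorem5_general e μ X hX.memLp (fun s s' => hX.cov_lag _ _ _ _ (sub_zero _).symm) γ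
    hC K hK.nonneg hK.bounded_support hLip t ht.distinct ht.mesh Δ 1 one_pos
    (hΔ.eventually_ge_atTop 1) x ρ hball hρΔ Θ hΘ
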